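/- Let $d,m\ge 0$ and $r\ge 2$ be integers and let $C>0$ be a real number. Let $A_1,\dots,A_d\in M_m(\mathbb C)$ be positive semidefinite matrices of rank $1$ with $\|A_i\|\le C$ for $i=1,\dots,d$ and $\sum_{i=1}^d A_i=1_m$, where $\|\cdot\|$ denotes the operator norm induced by the Euclidean norm on $\mathbb C^m$ and $1_m$ is the identity matrix. Then there exist pairwise disjoint sets $S_1,\dots,S_r$ with union $\{1,\dots,d\}$, all of them nonempty if $r\le d$ (for $r>d$ some are necessarily empty), such that $$\Bigl\|\sum_{i\in S_j}A_i\Bigr\|\le\Bigl(\sqrt{\tfrac1r}+\sqrt C\Bigr)^2\qquad\text{for every } j=1,\dots,r.$$ -/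

import Mathlib

-- Matrices over ℂ carry the operator norm induced by the Euclidean norm; `ComplexOrder` is the
-- usual partial order of ℂ that `Matrix.PosSemidef` is formulated with.
open scoped Matrix.Norms.L2Operator ComplexOrder

/-!
The proof follows the method of interlacing polynomials of Marcus, Spielman and Srivastava, in a
form that works with multi-affine polynomials throughout.

For `d` matrices and `r` colours let `P (z) = ∏ j, det (∑ i, z (i, j) A i)`, a real polynomial in
the variables `z (i, j)`. Since the `A i` are positive semidefinite with sum `1`, `P` is stable: it
has no zero with all coordinates in the upper half-plane. Since they have rank one, `P` is affine
in each variable, so that `1 - r ∂_(i, j)` acts on it as the translation of `z (i, j)` by `-r`.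
Applying such an operator for every `i`, with a colour `j = c i`, and then setting all variables
equal to `x` gives `∏ j, det (x - r ∑_{c i = j} A i)`. Hence the bound wanted for the colouring `c`
says that `(x, …, x)` lies above the zeros of the resulting polynomial, where
`x = (1 + √(r C)) ^ 2`.

The average of the operators over the colours `j` is `1 - D_i`, with `D_i = ∑ j, ∂_(i, j)`. Two facts
about a stable polynomial `p` and directions `v, w ≥ 0` carry the argument; both concern the
potential `D_w p / p`.

* Averaging (`IsStable.exists_isAbove_of_average`): if a point is above the zeros of the polynomial
  obtained from the averaged operator, it is above the zeros of the polynomial obtained from one of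
  the operators averaged. Indeed being above the zeros of `(1 - D_v) p` amounts to a potential less
  than `1`, the potential is linear in its direction, and it decreases when the point moves up.
* Barrier step (`IsStable.barrier`): if the potential in direction `v` is at most `1 - 1/δ`, then
  passing to `(1 - D_v) p` and moving the point by `δ v` increases no potential. This uses that the
  potential is decreasing and convex along `v`.

Starting the barrier argument at `(t, …, t)` with `t = r C + √(r C)`, where the potential of `P` in
the direction of `D_i` is at most `r C / t`, and taking `δ = 1 + √(r C)`, one arrives at `(x, …, x)`
after all `1 - D_i` have been applied. The averaging step then selects the colours one by one.

Monotonicity and convexity of potentials are statements about one variable: on a line, `D_w p / p`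
is a rational function `g / f` with real-rooted `f` that maps the upper half-plane to the closed
lower one. Its growth near a zero of `f` and at infinity shows that it has only simple poles, with
nonnegative residues, and an affine polynomial part with nonpositive slope
(`PickPair.partial_fractions`). Both properties can be read off from this expansion.

Finally, moving single indices to unused colours makes all classes nonempty, because `‖A i‖ ≤ C`.
-/

open Polynomial ComplexConjugate Filter Topology

/-! ### Pick-type rational functions of one variable -/

/-- A sign condition on `g * conj f` near a zero `w` of `f = (X - w) ^ m * u`, read off to leading
order along the ray from `w` in direction `ω`. -/
lemma im_mul_conj_le_zero_of_eventually {u g : ℂ[X]} {w ω : ℂ} {m : ℕ}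
    (h : ∀ᶠ t : ℝ in 𝓝[>] 0,
      (g.eval (w + t * ω) * conj ((t * ω) ^ m * u.eval (w + t * ω))).im ≤ 0) :
    (g.eval w * conj (ω ^ m * u.eval w)).im ≤ 0 := by
  have hc : Continuous fun t : ℝ =>
      (g.eval (w + t * ω) * conj (ω ^ m * u.eval (w + t * ω))).im := by fun_prop
  have ht := (hc.tendsto 0).mono_left (nhdsWithin_le_nhds (s := Set.Ioi 0))
  simp only [Complex.ofReal_zero, zero_mul, add_zero] at ht
  refine le_of_tendsto ht ?_
  filter_upwards [h, self_mem_nhdsWithin] with t h1 (h2 : 0 < t)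
  have : (g.eval (w + t * ω) * conj ((t * ω) ^ m * u.eval (w + t * ω))) =
      ((t ^ m : ℝ) : ℂ) * (g.eval (w + t * ω) * conj (ω ^ m * u.eval (w + t * ω))) := by
    simp only [map_mul, map_pow, Complex.conj_ofReal, mul_pow, Complex.ofReal_pow]; ring
  rw [this, Complex.im_ofReal_mul] at h1
  exact nonpos_of_mul_nonpos_right h1 (by positivity)

/-- If `Im (f' / f) ≤ 0` holds in the closed upper half-plane away from the zeros, then there are
no zeros in the open upper half-plane: near a zero `w` the quotient behaves like `m / (z - w)`,
whose imaginary part is positive below `w`. -/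
lemma eval_ne_zero_of_im_derivative_mul_conj_le_zero {f : ℂ[X]} (hf : f ≠ 0)
    (h : ∀ z : ℂ, 0 ≤ z.im → (f.derivative.eval z * conj (f.eval z)).im ≤ 0)
    {w : ℂ} (hw : 0 < w.im) : f.eval w ≠ 0 := by
  intro h0
  obtain ⟨u, hu, hdvd⟩ := exists_eq_pow_rootMultiplicity_mul_and_not_dvd f hf w
  have hm : 0 < rootMultiplicity w f := (rootMultiplicity_pos hf).2 h0
  obtain ⟨k, hk⟩ : ∃ k, rootMultiplicity w f = k + 1 := ⟨_, (Nat.succ_pred_eq_of_pos hm).symm⟩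
  rw [hk] at hu
  have huw : u.eval w ≠ 0 := fun h' => hdvd (dvd_iff_isRoot.2 h')
  have hd : f.derivative = (X - C w) ^ k * (C ((k : ℂ) + 1) * u + (X - C w) * derivative u) := by
    rw [hu]; simp [derivative_mul, derivative_X_sub_C_pow]; ring
  have := im_mul_conj_le_zero_of_eventually (u := u)
    (g := C ((k : ℂ) + 1) * u + (X - C w) * derivative u) (w := w) (ω := -Complex.I) (m := 1) ?_
  · have e : (eval w (C ((k : ℂ) + 1) * u + (X - C w) * derivative u) *
        conj ((-Complex.I) ^ 1 * u.eval w)) =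
        (((k : ℝ) + 1) * Complex.normSq (u.eval w) : ℝ) * Complex.I := by
      push_cast
      rw [Complex.normSq_eq_conj_mul_self]
      simp
      ring
    rw [e, Complex.im_ofReal_mul, Complex.I_im, mul_one] at this
    have h3 := Complex.normSq_pos.2 huw
    have : 0 < ((k : ℝ) + 1) * Complex.normSq (u.eval w) := by positivity
    linarith
  · filter_upwards [self_mem_nhdsWithin, nhdsWithin_le_nhds (gt_mem_nhds hw)] with t
      (ht : 0 < t) ht'
    set z := w + t * -Complex.I with hz
    have h1 := h z (by simp [hz]; linarith)
    have hzw : z - w = t * -Complex.I := by rw [hz]; ring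
    rw [hd, hu] at h1
    have e : eval z ((X - C w) ^ k * (C ((k : ℂ) + 1) * u + (X - C w) * derivative u)) *
        conj (eval z ((X - C w) ^ (k + 1) * u)) =
        (Complex.normSq ((z - w) ^ k) : ℝ) *
        (eval z (C ((k : ℂ) + 1) * u + (X - C w) * derivative u) *
          conj ((t * -Complex.I) ^ 1 * eval z u)) := by
      rw [← hzw, Complex.normSq_eq_conj_mul_self]
      simp only [eval_mul, eval_pow, eval_sub, eval_X, eval_C, map_mul, map_pow]
      ring
    rw [e, Complex.im_ofReal_mul] at h1
    refine nonpos_of_mul_nonpos_right h1 (Complex.normSq_pos.2 (pow_ne_zero _ ?_))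
    rw [hzw]
    simp [ht.ne']

/-- An `m`-th root of `I` in the open upper half-plane. -/
lemma exists_pow_eq_I {m : ℕ} (hm : 1 ≤ m) :
    ∃ ω : ℂ, 0 < ω.im ∧ ‖ω‖ = 1 ∧ ω ^ m = Complex.I := by
  have hm' : (1 : ℝ) ≤ m := by exact_mod_cast hm
  have hpi := Real.pi_pos
  refine ⟨Complex.exp ((Real.pi / (2 * m) : ℝ) * Complex.I), ?_, ?_, ?_⟩
  · rw [Complex.exp_ofReal_mul_I_im]
    refine Real.sin_pos_of_pos_of_lt_pi (by positivity) ?_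
    rw [div_lt_iff₀ (by positivity)]
    nlinarith
  · exact Complex.norm_exp_ofReal_mul_I _
  · rw [← Complex.exp_nat_mul]
    have : (m : ℂ) * ((Real.pi / (2 * m) : ℝ) * Complex.I) = Real.pi / 2 * Complex.I := by
      have : (m : ℂ) ≠ 0 := by exact_mod_cast (by omega : m ≠ 0)
      push_cast; field_simp
    rw [this, Complex.exp_pi_div_two_mul_I]

/-- For `2 ≤ m`, the open upper half-plane also contains an `m`-th root of `-I`. -/
lemma exists_pow_eq_neg_I {m : ℕ} (hm : 2 ≤ m) :
    ∃ ω : ℂ, 0 < ω.im ∧ ‖ω‖ = 1 ∧ ω ^ m = -Complex.I := by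
  have hm' : (2 : ℝ) ≤ m := by exact_mod_cast hm
  have hpi := Real.pi_pos
  refine ⟨Complex.exp ((3 * Real.pi / (2 * m) : ℝ) * Complex.I), ?_, ?_, ?_⟩
  · rw [Complex.exp_ofReal_mul_I_im]
    refine Real.sin_pos_of_pos_of_lt_pi (by positivity) ?_
    rw [div_lt_iff₀ (by positivity)]
    nlinarith
  · exact Complex.norm_exp_ofReal_mul_I _
  · rw [← Complex.exp_nat_mul]
    have : (m : ℂ) * ((3 * Real.pi / (2 * m) : ℝ) * Complex.I) =
        Real.pi * Complex.I + Real.pi / 2 * Complex.I := by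
      have : (m : ℂ) ≠ 0 := by exact_mod_cast (by omega : m ≠ 0)
      push_cast; field_simp; ring
    rw [this, Complex.exp_add, Complex.exp_pi_div_two_mul_I, Complex.exp_pi_mul_I]
    ring

/-- `f` and `g` form a *Pick pair* when `Im (g / f) ≤ 0` on the open upper half-plane, phrased
without division. -/
def PickPair (f g : ℝ[X]) : Prop :=
  ∀ z : ℂ, 0 < z.im → (aeval z g * conj (aeval z f)).im ≤ 0

lemma aeval_eq_eval_map (z : ℂ) (f : ℝ[X]) :
    aeval z f = (f.map (algebraMap ℝ ℂ)).eval z := by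
  rw [aeval_def, eval_map]

lemma aeval_ofReal_complex (x : ℝ) (f : ℝ[X]) : aeval (x : ℂ) f = (f.eval x : ℝ) :=
  aeval_algebraMap_apply_eq_algebraMap_eval x f

/-- Leading-order form of the Pick condition at a real zero of order `m`. -/
lemma PickPair.leading_at_zero {u g : ℝ[X]} {y : ℝ} {m : ℕ}
    (h : PickPair ((X - C y) ^ m * u) g) {ω : ℂ} (hω : 0 < ω.im) :
    0 ≤ g.eval y * u.eval y * (ω ^ m).im := by
  have := im_mul_conj_le_zero_of_eventually (u := u.map (algebraMap ℝ ℂ))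
    (g := g.map (algebraMap ℝ ℂ)) (w := y) (ω := ω) (m := m) ?_
  · rw [← aeval_eq_eval_map, ← aeval_eq_eval_map, aeval_ofReal_complex, aeval_ofReal_complex,
      map_mul, Complex.conj_ofReal, Complex.im_ofReal_mul, Complex.im_mul_ofReal,
      Complex.conj_im] at this
    linarith
  · filter_upwards [self_mem_nhdsWithin] with t (ht : 0 < t)
    have h1 := h (y + t * ω) (by simp; positivity)
    simp only [map_mul, map_pow, map_sub, aeval_X, aeval_C, Complex.coe_algebraMap,
      add_sub_cancel_left] at h1
    simpa only [aeval_eq_eval_map, map_mul, map_pow] using h1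

lemma tendsto_aeval_mul_div_pow (g : ℝ[X]) (ω : ℂ) :
    Tendsto (fun t : ℝ => aeval (t * ω) g / (t : ℂ) ^ g.natDegree) atTop
      (𝓝 (g.leadingCoeff * ω ^ g.natDegree)) := by
  have key : ∀ i ∈ Finset.range (g.natDegree + 1),
      Tendsto (fun t : ℝ => (g.coeff i : ℂ) * (t * ω) ^ i / (t : ℂ) ^ g.natDegree) atTop
      (𝓝 (if i = g.natDegree then (g.coeff i : ℂ) * ω ^ i else 0)) := by
    intro i hi
    rw [Finset.mem_range] at hi
    split_ifs with h
    · subst h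
      refine tendsto_const_nhds.congr' ?_
      filter_upwards [eventually_gt_atTop 0] with t ht
      have : (t : ℂ) ≠ 0 := by exact_mod_cast ht.ne'
      rw [mul_pow]; field_simp
    · have h1 : Tendsto (fun t : ℝ => (t ^ (g.natDegree - i))⁻¹) atTop (𝓝 0) :=
        (tendsto_pow_atTop (by omega)).inv_tendsto_atTop
      have h2 : Tendsto (fun t : ℝ => (g.coeff i : ℂ) * ω ^ i *
          (((t ^ (g.natDegree - i))⁻¹ : ℝ) : ℂ)) atTop (𝓝 ((g.coeff i : ℂ) * ω ^ i * (0 : ℝ))) :=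
        tendsto_const_nhds.mul ((Complex.continuous_ofReal.tendsto 0).comp h1)
      rw [Complex.ofReal_zero, mul_zero] at h2
      refine h2.congr' ?_
      filter_upwards [eventually_gt_atTop 0] with t ht
      have : (t : ℂ) ≠ 0 := by exact_mod_cast ht.ne'
      obtain ⟨k, hk⟩ : ∃ k, g.natDegree = i + k := ⟨g.natDegree - i, by omega⟩
      rw [hk, Nat.add_sub_cancel_left]
      push_cast
      rw [mul_pow, pow_add]
      field_simp
  have := tendsto_finsetSum _ key
  simp only [Finset.sum_ite_eq', Finset.mem_range, Nat.lt_succ_self, if_true] at this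
  refine this.congr fun t => ?_
  rw [aeval_eq_sum_range, Finset.sum_div]
  exact Finset.sum_congr rfl fun i _ => by rw [Algebra.smul_def]; rfl

/-- Leading-order form of the Pick condition at infinity. -/
lemma PickPair.leading_at_infinity {f g : ℝ[X]} (h : PickPair f g) {k : ℕ}
    (hk : g.natDegree = f.natDegree + k) {ω : ℂ} (hω : 0 < ω.im) (h1 : ‖ω‖ = 1) :
    f.leadingCoeff * g.leadingCoeff * (ω ^ k).im ≤ 0 := by
  have ht := (tendsto_aeval_mul_div_pow g ω).mul
    ((Complex.continuous_conj.tendsto _).comp (tendsto_aeval_mul_div_pow f ω))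
  have e : (g.leadingCoeff * ω ^ g.natDegree * conj (f.leadingCoeff * ω ^ f.natDegree) : ℂ) =
      ((f.leadingCoeff * g.leadingCoeff : ℝ) : ℂ) * ω ^ k := by
    have : ω * conj ω = 1 := by
      rw [Complex.mul_conj, Complex.normSq_eq_norm_sq, h1]; simp
    rw [hk, map_mul, map_pow, Complex.conj_ofReal, pow_add]
    calc _ = ((f.leadingCoeff * g.leadingCoeff : ℝ) : ℂ) * ω ^ k * (ω * conj ω) ^ f.natDegree := by
          push_cast; ring
      _ = _ := by rw [this]; simp
  rw [e] at ht
  have := le_of_tendsto ((Complex.continuous_im.tendsto _).comp ht) (b := 0) ?_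
  · rwa [Complex.im_ofReal_mul] at this
  · filter_upwards [eventually_gt_atTop 0] with t ht
    have h2 := h (t * ω) (by rw [Complex.im_ofReal_mul]; positivity)
    have : aeval (t * ω) g / (t : ℂ) ^ g.natDegree *
        conj (aeval (t * ω) f / (t : ℂ) ^ f.natDegree) =
        ((t ^ (g.natDegree + f.natDegree))⁻¹ : ℝ) * (aeval (t * ω) g * conj (aeval (t * ω) f)) := by
      rw [map_div₀, map_pow, Complex.conj_ofReal, pow_add]
      push_cast
      field_simp
    simp only [Function.comp]
    rw [this, Complex.im_ofReal_mul]
    exact mul_nonpos_of_nonneg_of_nonpos (by positivity) h2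

/-- A real polynomial without zeros in the upper half-plane is real-rooted. -/
lemma splits_of_aeval_ne_zero {f : ℝ[X]} (h : ∀ z : ℂ, 0 < z.im → aeval z f ≠ 0) :
    f.Splits := by
  refine Splits.of_splits_map (algebraMap ℝ ℂ) (IsAlgClosed.splits _) fun a ha => ?_
  have ha0 : aeval a f = 0 := by
    rw [aeval_eq_eval_map]; exact (mem_roots'.1 ha).2
  refine ⟨a.re, ?_⟩
  have him : a.im = 0 := by
    rcases lt_trichotomy a.im 0 with h1 | h1 | h1
    · refine absurd ?_ (h (conj a) (by simpa using h1))
      rw [aeval_conj, ha0, map_zero]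
    · exact h1
    · exact absurd ha0 (h a h1)
  exact Complex.ext (by simp) (by simp [him])

/-- Partial fractions of a Pick pair without common zeros: all poles are simple, residues at the
poles are nonnegative, and the polynomial part is affine with nonpositive slope. -/
lemma PickPair.partial_fractions_of_isCoprime {f g : ℝ[X]} (hsplit : f.Splits) (hf : f ≠ 0)
    (hco : IsCoprime f g) (h : PickPair f g) :
    ∃ (s : Finset ℝ) (c : ℝ → ℝ) (α β : ℝ), β ≤ 0 ∧ (∀ y ∈ s, 0 ≤ c y) ∧
      (∀ y ∈ s, f.eval y = 0) ∧
      ∀ x, f.eval x ≠ 0 → g.eval x / f.eval x = α + β * x + ∑ y ∈ s, c y / (x - y) := by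
  classical
  have hnc : ∀ y, f.eval y = 0 → g.eval y ≠ 0 := by
    intro y h1 h2
    obtain ⟨a, b, hab⟩ := hco
    have := congrArg (eval y) hab
    simp [h1, h2] at this
  have hdegle : g.natDegree ≤ f.natDegree + 1 := by
    by_contra! hlt
    obtain ⟨k, hk⟩ : ∃ k, g.natDegree = f.natDegree + k := ⟨g.natDegree - f.natDegree, by omega⟩
    obtain ⟨ω₁, p1, q1, r1⟩ := exists_pow_eq_I (m := k) (by omega)
    obtain ⟨ω₂, p2, q2, r2⟩ := exists_pow_eq_neg_I (m := k) (by omega)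
    have e1 := h.leading_at_infinity hk p1 q1
    have e2 := h.leading_at_infinity hk p2 q2
    rw [r1, Complex.I_im] at e1
    rw [r2, Complex.neg_im, Complex.I_im] at e2
    have hg : g ≠ 0 := by rintro rfl; simp at hlt
    have : f.leadingCoeff * g.leadingCoeff ≠ 0 := by
      simp [hf, hg]
    exact this (by linarith)
  have hsimple : ∀ y, f.eval y = 0 → rootMultiplicity y f ≤ 1 := by
    intro y hy
    by_contra! hlt
    obtain ⟨u, hu, hdvd⟩ := exists_eq_pow_rootMultiplicity_mul_and_not_dvd f hf y
    have huy : u.eval y ≠ 0 := fun h' => hdvd (dvd_iff_isRoot.2 h')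
    obtain ⟨ω₁, p1, -, r1⟩ := exists_pow_eq_I (m := rootMultiplicity y f) (by omega)
    obtain ⟨ω₂, p2, -, r2⟩ := exists_pow_eq_neg_I (m := rootMultiplicity y f) (by omega)
    have h' := h
    rw [hu] at h'
    have e1 := h'.leading_at_zero p1
    have e2 := h'.leading_at_zero p2
    rw [r1, Complex.I_im] at e1
    rw [r2, Complex.neg_im, Complex.I_im] at e2
    exact mul_ne_zero (hnc y hy) huy (by linarith)
  have hnodup : f.roots.Nodup := by
    rw [Multiset.nodup_iff_count_le_one]
    intro y
    rw [count_roots]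
    by_cases hy : f.eval y = 0
    · exact hsimple y hy
    · rw [rootMultiplicity_eq_zero hy]; omega
  set s := f.roots.toFinset with hs
  set a := f.leadingCoeff with ha
  have ha0 : a ≠ 0 := leadingCoeff_ne_zero.2 hf
  have hmem : ∀ y, y ∈ s ↔ f.eval y = 0 := by
    intro y; rw [hs, Multiset.mem_toFinset, mem_roots hf]; rfl
  have hfs : f = C a * Lagrange.nodal s id := by
    conv_lhs => rw [hsplit.eq_prod_roots]
    rw [Lagrange.nodal_eq, Finset.prod_eq_multiset_prod, hs, Multiset.toFinset_val,
      hnodup.dedup]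
    simp [ha]
  have hdeg : f.degree = s.card := by
    rw [hfs, degree_C_mul ha0, Lagrange.degree_nodal]
  set L := g / f with hL
  set r := g % f with hr
  have hgr : g = f * L + r := (EuclideanDomain.div_add_mod g f).symm
  have hrdeg : r.degree < s.card := hdeg ▸ EuclideanDomain.mod_lt g hf
  have hLdeg : L.natDegree ≤ 1 := by
    by_contra! hlt
    have hL0 : L ≠ 0 := by rintro h0; rw [h0] at hlt; simp at hlt
    have h1 : (f * L).natDegree = f.natDegree + L.natDegree := natDegree_mul hf hL0
    have h2 : r.degree < (f * L).degree := by
      rw [degree_mul, degree_eq_natDegree hL0]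
      refine lt_of_lt_of_le (EuclideanDomain.mod_lt g hf) ?_
      exact le_add_of_nonneg_right (by exact_mod_cast Nat.zero_le _)
    have h3 : g.natDegree = (f * L).natDegree := by
      conv_lhs => rw [hgr]
      exact natDegree_add_eq_left_of_degree_lt h2
    omega
  have hLeq : ∀ x, L.eval x = L.coeff 0 + L.coeff 1 * x := by
    intro x
    conv_lhs => rw [eq_X_add_C_of_natDegree_le_one hLdeg]
    simp; ring
  have hβ : L.coeff 1 ≤ 0 := by
    by_cases h1 : L.coeff 1 = 0
    · exact h1.le
    have hL1 : L.natDegree = 1 := le_antisymm hLdeg (le_natDegree_of_ne_zero h1)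
    have hL0 : L ≠ 0 := by rintro h0; rw [h0] at hL1; simp at hL1
    have h2 : r.degree < (f * L).degree := by
      rw [degree_mul, degree_eq_natDegree hL0]
      refine lt_of_lt_of_le (EuclideanDomain.mod_lt g hf) ?_
      exact le_add_of_nonneg_right (by exact_mod_cast Nat.zero_le _)
    have h3 : g.natDegree = f.natDegree + 1 := by
      conv_lhs => rw [hgr]
      rw [natDegree_add_eq_left_of_degree_lt h2, natDegree_mul hf hL0, hL1]
    have h4 : g.leadingCoeff = a * L.coeff 1 := by
      conv_lhs => rw [hgr]
      rw [leadingCoeff_add_of_degree_lt' h2, leadingCoeff_mul, ← hL1]; rfl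
    have := h.leading_at_infinity h3 (ω := Complex.I) (by simp) (by simp)
    rw [h4, pow_one, Complex.I_im, mul_one, ← mul_assoc] at this
    exact nonpos_of_mul_nonpos_right this (mul_self_pos.2 ha0)
  refine ⟨s, fun y => a⁻¹ * Lagrange.nodalWeight s id y * g.eval y, L.coeff 0, L.coeff 1, hβ,
    fun y hy => ?_, fun y hy => (hmem y).1 hy, fun x hx => ?_⟩
  · have hfy : f = (X - C y) ^ 1 * (C a * Lagrange.nodal (s.erase y) id) := by
      conv_lhs => rw [hfs, Lagrange.nodal_eq_mul_nodal_erase hy]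
      simp only [id, pow_one]; ring
    have h' := h
    rw [hfy] at h'
    have h1 := h'.leading_at_zero (ω := Complex.I) (by simp)
    rw [pow_one, Complex.I_im, mul_one, eval_mul, eval_C] at h1
    have hw : Lagrange.nodalWeight s id y = (eval y (Lagrange.nodal (s.erase y) id))⁻¹ :=
      Lagrange.nodalWeight_eq_eval_nodal_erase_inv
    beta_reduce
    rw [hw, ← mul_inv]
    set b := a * eval y (Lagrange.nodal (s.erase y) id)
    have : b⁻¹ * g.eval y = g.eval y * b * (b⁻¹) ^ 2 := by
      by_cases hb : b = 0
      · simp [hb]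
      · field_simp
    rw [this]
    positivity
  · have hr' := Lagrange.eq_interpolate (s := s) (v := id) (Set.injOn_id _) hrdeg
    have hxs : ∀ i ∈ s, x ≠ id i := by
      rintro i hi rfl
      exact hx ((hmem _).1 hi)
    have h1 := Lagrange.eval_interpolate_not_at_node (fun i => eval (id i) r) hxs
    rw [← hr'] at h1
    have hfx : f.eval x = a * eval x (Lagrange.nodal s id) := by
      conv_lhs => rw [hfs]
      simp
    have hn : eval x (Lagrange.nodal s id) ≠ 0 := by
      intro h0; rw [hfx, h0, mul_zero] at hx; exact hx rfl
    have hgx : g.eval x = f.eval x * L.eval x + r.eval x := by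
      conv_lhs => rw [hgr]
      simp
    rw [hgx, add_div, mul_div_cancel_left₀ _ hx, hLeq, h1, hfx]
    congr 1
    rw [mul_comm a, mul_div_mul_left _ _ hn, Finset.sum_div]
    refine Finset.sum_congr rfl fun y hy => ?_
    have : g.eval y = r.eval y := by
      conv_lhs => rw [hgr]
      simp [(hmem y).1 hy]
    simp only [id, this]
    field_simp

/-- Partial fractions of a Pick pair with real-rooted denominator. -/
lemma PickPair.partial_fractions {f g : ℝ[X]} (hf : f ≠ 0)
    (hroot : ∀ z : ℂ, 0 < z.im → aeval z f ≠ 0) (h : PickPair f g) :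
    ∃ (s : Finset ℝ) (c : ℝ → ℝ) (α β : ℝ), β ≤ 0 ∧ (∀ y ∈ s, 0 ≤ c y) ∧
      (∀ y ∈ s, f.eval y = 0) ∧
      ∀ x, f.eval x ≠ 0 → g.eval x / f.eval x = α + β * x + ∑ y ∈ s, c y / (x - y) := by
  classical
  set q := EuclideanDomain.gcd f g with hq
  have hq0 : q ≠ 0 := fun h0 => hf (EuclideanDomain.gcd_eq_zero_iff.1 h0).1
  obtain ⟨f₁, hf₁⟩ := EuclideanDomain.gcd_dvd_left f g
  obtain ⟨g₁, hg₁⟩ := EuclideanDomain.gcd_dvd_right f g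
  rw [← hq] at hf₁ hg₁
  have hf₁0 : f₁ ≠ 0 := by rintro rfl; simp at hf₁; exact hf hf₁
  have hco : IsCoprime f₁ g₁ := by
    obtain ⟨a, b, hab⟩ : ∃ a b, a * f + b * g = q :=
      ⟨EuclideanDomain.gcdA f g, EuclideanDomain.gcdB f g,
        by rw [hq, EuclideanDomain.gcd_eq_gcd_ab f g]; ring⟩
    refine ⟨a, b, mul_left_cancel₀ hq0 ?_⟩
    calc q * (a * f₁ + b * g₁) = a * (q * f₁) + b * (q * g₁) := by ring
      _ = q * 1 := by rw [← hf₁, ← hg₁, hab, mul_one]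
  have hsplit : f₁.Splits := (splits_of_aeval_ne_zero hroot).of_dvd hf ⟨q, by rw [hf₁]; ring⟩
  have hP : PickPair f₁ g₁ := by
    intro z hz
    have h1 := h z hz
    have hqz : aeval z q ≠ 0 := by
      intro h0; apply hroot z hz; rw [hf₁, map_mul, h0, zero_mul]
    have e : aeval z g * conj (aeval z f) =
        (Complex.normSq (aeval z q) : ℝ) * (aeval z g₁ * conj (aeval z f₁)) := by
      rw [hf₁, hg₁, Complex.normSq_eq_conj_mul_self]; simp only [map_mul]; ring
    rw [e, Complex.im_ofReal_mul] at h1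
    exact nonpos_of_mul_nonpos_right h1 (Complex.normSq_pos.2 hqz)
  obtain ⟨s, c, α, β, hβ, hc, hs, hx⟩ := hP.partial_fractions_of_isCoprime hsplit hf₁0 hco
  refine ⟨s, c, α, β, hβ, hc, fun y hy => by rw [hf₁, eval_mul, hs y hy, mul_zero], fun x hfx => ?_⟩
  rw [hf₁, eval_mul] at hfx
  rw [← hx x (right_ne_zero_of_mul hfx), hf₁, hg₁, eval_mul, eval_mul,
    mul_div_mul_left _ _ (left_ne_zero_of_mul hfx)]

/-- Beyond the largest zero of `f`, the quotient `g / f` of a Pick pair is decreasing. -/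
lemma PickPair.div_antitone {f g : ℝ[X]} (hf : f ≠ 0)
    (hroot : ∀ z : ℂ, 0 < z.im → aeval z f ≠ 0) (h : PickPair f g) {a b : ℝ}
    (hpos : ∀ x, a ≤ x → 0 < f.eval x) (hab : a ≤ b) :
    g.eval b / f.eval b ≤ g.eval a / f.eval a := by
  obtain ⟨s, c, α, β, hβ, hc, hs, hx⟩ := h.partial_fractions hf hroot
  rw [hx a (hpos a le_rfl).ne', hx b (hpos b hab).ne']
  have h1 : β * b ≤ β * a := mul_le_mul_of_nonpos_left hab hβ
  have h2 : ∑ y ∈ s, c y / (b - y) ≤ ∑ y ∈ s, c y / (a - y) := by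
    refine Finset.sum_le_sum fun y hy => ?_
    have : y < a := by
      by_contra! hya
      exact (hpos y hya).ne' (hs y hy)
    exact div_le_div_of_nonneg_left (hc y hy) (by linarith) (by linarith)
  linarith

/-- Beyond the largest zero of `f`, the quotient `R = g / f` of a Pick pair has nonpositive
derivative and is convex, in the form of a tangent inequality at `b`, with the quotient rule
written out. -/
lemma PickPair.tangent_le {f g : ℝ[X]} (hf : f ≠ 0)
    (hroot : ∀ z : ℂ, 0 < z.im → aeval z f ≠ 0) (h : PickPair f g) {a b : ℝ}
    (hpos : ∀ x, a ≤ x → 0 < f.eval x) (hab : a ≤ b) :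
    g.derivative.eval b * f.eval b - g.eval b * f.derivative.eval b ≤ 0 ∧
    g.eval b / f.eval b - (b - a) *
      ((g.derivative.eval b * f.eval b - g.eval b * f.derivative.eval b) / f.eval b ^ 2)
      ≤ g.eval a / f.eval a := by
  obtain ⟨s, c, α, β, hβ, hc, hs, hx⟩ := h.partial_fractions hf hroot
  have hfb := hpos b hab
  have hlt : ∀ y ∈ s, y < a := fun y hy => by
    by_contra! hya
    exact (hpos y hya).ne' (hs y hy)
  have hd1 : HasDerivAt (fun x => g.eval x / f.eval x)
      ((g.derivative.eval b * f.eval b - g.eval b * f.derivative.eval b) / f.eval b ^ 2) b :=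
    (g.hasDerivAt b).div (f.hasDerivAt b) hfb.ne'
  have hd2 : HasDerivAt (fun x => α + β * x + ∑ y ∈ s, c y / (x - y))
      (β + ∑ y ∈ s, -(c y / (b - y) ^ 2)) b := by
    have h1 : HasDerivAt (fun x => α + β * x) β b := by
      simpa using ((hasDerivAt_id b).const_mul β).const_add α
    refine h1.add (HasDerivAt.fun_sum fun y hy => ?_)
    have hby : b - y ≠ 0 := by have := hlt y hy; intro h0; linarith
    have := (hasDerivAt_const b (c y)).div ((hasDerivAt_id b).sub_const y) hby
    convert! this using 1
    simp; ring
  have hE : (fun x => g.eval x / f.eval x) =ᶠ[𝓝 b]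
      (fun x => α + β * x + ∑ y ∈ s, c y / (x - y)) := by
    filter_upwards [f.continuous.continuousAt.eventually_ne hfb.ne'] with x hxx using hx x hxx
  have heq := (hd1.congr_of_eventuallyEq hE.symm).unique hd2
  have hneg : ∑ y ∈ s, -(c y / (b - y) ^ 2) ≤ 0 :=
    Finset.sum_nonpos fun y hy => by have := hc y hy; simp only [Left.neg_nonpos_iff]; positivity
  constructor
  · have : (g.derivative.eval b * f.eval b - g.eval b * f.derivative.eval b) / f.eval b ^ 2 ≤ 0 := by
      rw [heq]; linarith
    exact nonpos_of_mul_nonpos_left this (inv_pos.2 (pow_pos hfb 2))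
  · rw [heq, hx a (hpos a le_rfl).ne', hx b hfb.ne']
    have : ∑ y ∈ s, c y / (b - y) - (b - a) * ∑ y ∈ s, -(c y / (b - y) ^ 2) ≤
        ∑ y ∈ s, c y / (a - y) := by
      rw [Finset.mul_sum, ← Finset.sum_sub_distrib]
      refine Finset.sum_le_sum fun y hy => ?_
      have hya := hlt y hy
      have h1 : 0 < a - y := by linarith
      have h2 : 0 < b - y := by linarith
      have hcy := hc y hy
      have : c y / (a - y) - (c y / (b - y) - (b - a) * -(c y / (b - y) ^ 2)) =
          c y * (b - a) ^ 2 / ((a - y) * (b - y) ^ 2) := by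
        field_simp; ring
      have : 0 ≤ c y * (b - a) ^ 2 / ((a - y) * (b - y) ^ 2) := by positivity
      linarith
    linarith

/-! ### Stable polynomials and barrier potentials -/

variable {σ : Type*}

/-- The derivative of a real multivariate polynomial in the direction of a real vector `v`. -/
noncomputable def dirDeriv (v : σ → ℝ) :
    Derivation ℝ (MvPolynomial σ ℝ) (MvPolynomial σ ℝ) :=
  MvPolynomial.mkDerivation ℝ fun a => MvPolynomial.C (v a)

/-- The one-variable polynomial `s ↦ p (z + s v)`, for a base point with coordinates in an
`ℝ`-algebra and a real direction. -/
noncomputable def lineRestrict {K : Type*} [CommRing K] [Algebra ℝ K] (z : σ → K) (v : σ → ℝ) :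
    MvPolynomial σ ℝ →ₐ[ℝ] K[X] :=
  MvPolynomial.aeval fun a => C (z a) + C (algebraMap ℝ K (v a)) * X

section
variable {K : Type*} [CommRing K] [Algebra ℝ K]

lemma eval_lineRestrict (z : σ → K) (v : σ → ℝ) (p : MvPolynomial σ ℝ) (s : K) :
    (lineRestrict z v p).eval s =
      MvPolynomial.aeval (fun a => z a + s * algebraMap ℝ K (v a)) p := by
  induction p using MvPolynomial.induction_on with
  | C a => simp [lineRestrict, Polynomial.algebraMap_apply]
  | add p q hp hq => simp only [map_add, eval_add, hp, hq]
  | mul_X p a hp =>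
    have : (lineRestrict z v (MvPolynomial.X a)).eval s = z a + s * algebraMap ℝ K (v a) := by
      simp [lineRestrict]; ring
    rw [map_mul, eval_mul, hp, map_mul, this, MvPolynomial.aeval_X]

lemma derivative_lineRestrict (z : σ → K) (v : σ → ℝ) (p : MvPolynomial σ ℝ) :
    (lineRestrict z v p).derivative = lineRestrict z v (dirDeriv v p) := by
  induction p using MvPolynomial.induction_on with
  | C a => simp [lineRestrict, dirDeriv, Polynomial.algebraMap_apply]
  | add p q hp hq => simp only [map_add, hp, hq]
  | mul_X p a hp =>
    rw [map_mul, derivative_mul, hp, Derivation.leibniz, map_add, smul_eq_mul, smul_eq_mul,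
      map_mul, map_mul]
    simp [lineRestrict, dirDeriv, Polynomial.algebraMap_apply]
    ring

end

lemma eval_lineRestrict_real (y v : σ → ℝ) (p : MvPolynomial σ ℝ) (s : ℝ) :
    (lineRestrict y v p).eval s = MvPolynomial.eval (y + s • v) p := by
  rw [eval_lineRestrict]; rfl

lemma aeval_lineRestrict_real (y v : σ → ℝ) (p : MvPolynomial σ ℝ) (z : ℂ) :
    aeval z (lineRestrict y v p) = MvPolynomial.aeval (fun a => (y a : ℂ) + z * v a) p := by
  induction p using MvPolynomial.induction_on with
  | C a => simp [lineRestrict]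
  | add p q hp hq => simp only [map_add, hp, hq]
  | mul_X p a hp =>
    have : aeval z (lineRestrict y v (MvPolynomial.X a)) = (y a : ℂ) + z * v a := by
      simp [lineRestrict]; ring
    rw [map_mul, map_mul, hp, map_mul, this, MvPolynomial.aeval_X]

lemma dirDeriv_add (v w : σ → ℝ) (p : MvPolynomial σ ℝ) :
    dirDeriv (v + w) p = dirDeriv v p + dirDeriv w p := by
  have : (dirDeriv (v + w) : Derivation ℝ (MvPolynomial σ ℝ) (MvPolynomial σ ℝ)) =
      dirDeriv v + dirDeriv w :=
    MvPolynomial.derivation_ext fun i => by simp [dirDeriv]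
  rw [this]; rfl

lemma dirDeriv_smul (c : ℝ) (v : σ → ℝ) (p : MvPolynomial σ ℝ) :
    dirDeriv (c • v) p = c • dirDeriv v p := by
  have : (dirDeriv (c • v) : Derivation ℝ (MvPolynomial σ ℝ) (MvPolynomial σ ℝ)) =
      c • dirDeriv v :=
    MvPolynomial.derivation_ext fun i => by simp [dirDeriv, MvPolynomial.smul_eq_C_mul]
  rw [this]; rfl

lemma dirDeriv_sum {ι : Type*} (s : Finset ι) (v : ι → σ → ℝ) (p : MvPolynomial σ ℝ) :
    dirDeriv (∑ j ∈ s, v j) p = ∑ j ∈ s, dirDeriv (v j) p := by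
  classical
  induction s using Finset.induction_on with
  | empty =>
    simpa using dirDeriv_smul 0 (0 : σ → ℝ) p
  | insert a s ha ih => rw [Finset.sum_insert ha, Finset.sum_insert ha, dirDeriv_add, ih]

lemma dirDeriv_comm (v w : σ → ℝ) (p : MvPolynomial σ ℝ) :
    dirDeriv v (dirDeriv w p) = dirDeriv w (dirDeriv v p) := by
  have : ⁅(dirDeriv v : Derivation ℝ (MvPolynomial σ ℝ) (MvPolynomial σ ℝ)), dirDeriv w⁆ = 0 :=
    MvPolynomial.derivation_ext fun i => by simp [dirDeriv, Derivation.commutator_apply]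
  have h := DFunLike.congr_fun this p
  rw [Derivation.commutator_apply] at h
  exact sub_eq_zero.1 h

/-- A real polynomial is stable if it has no zero all of whose coordinates lie in the open upper
half-plane. -/
def IsStable (p : MvPolynomial σ ℝ) : Prop :=
  ∀ z : σ → ℂ, (∀ a, 0 < (z a).im) → MvPolynomial.aeval z p ≠ 0

/-- `y` lies above the zeros of `p`: `p` is positive on the orthant with corner `y`. -/
def IsAbove (p : MvPolynomial σ ℝ) (y : σ → ℝ) : Prop :=
  ∀ t : σ → ℝ, 0 ≤ t → 0 < MvPolynomial.eval (y + t) p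

/-- The barrier potential of `p` at `y`: the logarithmic derivative in direction `w`. -/
noncomputable def potential (w : σ → ℝ) (p : MvPolynomial σ ℝ) (y : σ → ℝ) : ℝ :=
  MvPolynomial.eval y (dirDeriv w p) / MvPolynomial.eval y p

lemma multiset_sum_im_neg {s : Multiset ℂ} (h : ∀ x ∈ s, x.im < 0) :
    s = 0 ∨ s.sum.im < 0 := by
  induction s using Multiset.induction_on with
  | empty => exact Or.inl rfl
  | cons a s ih =>
    right
    have ha := h a (Multiset.mem_cons_self a s)
    rw [Multiset.sum_cons, Complex.add_im]
    rcases ih fun x hx => h x (Multiset.mem_cons_of_mem hx) with rfl | h'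
    · simpa using ha
    · linarith

/-- The logarithmic derivative at `0` of a polynomial whose zeros all lie in the open lower
half-plane has nonpositive imaginary part and is different from `1`. -/
lemma logDeriv_zero_of_eval_ne_zero {q : ℂ[X]} (h : ∀ s : ℂ, 0 ≤ s.im → q.eval s ≠ 0) :
    (q.derivative.eval 0 * conj (q.eval 0)).im ≤ 0 ∧ q.eval 0 - q.derivative.eval 0 ≠ 0 := by
  have h0 : q.eval 0 ≠ 0 := h 0 le_rfl
  have hR := (IsAlgClosed.splits q).eval_derivative_div_eval_of_ne_zero h0
  have hneg : ∀ x ∈ q.roots.map (fun z => 1 / (0 - z)), x.im < 0 := by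
    intro x hx
    obtain ⟨ρ, hρ, rfl⟩ := Multiset.mem_map.1 hx
    have him : ρ.im < 0 := by
      by_contra! hc
      exact h ρ hc (mem_roots'.1 hρ).2
    rw [zero_sub, one_div, Complex.inv_im, Complex.neg_im, neg_neg]
    refine div_neg_of_neg_of_pos him (Complex.normSq_pos.2 ?_)
    intro h0
    rw [neg_eq_zero] at h0
    simp [h0] at him
  have hd : q.derivative.eval 0 = q.eval 0 * (q.roots.map (fun z => 1 / (0 - z))).sum := by
    rw [← hR]; field_simp
  set S := (q.roots.map (fun z => 1 / (0 - z))).sum with hS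
  have hcase : S = 0 ∨ S.im < 0 := by
    rcases multiset_sum_im_neg hneg with h1 | h1
    · left; rw [hS, h1, Multiset.sum_zero]
    · exact Or.inr h1
  constructor
  · have : q.derivative.eval 0 * conj (q.eval 0) = (Complex.normSq (q.eval 0) : ℝ) * S := by
      rw [hd, Complex.normSq_eq_conj_mul_self]; ring
    rw [this, Complex.im_ofReal_mul]
    refine mul_nonpos_of_nonneg_of_nonpos (Complex.normSq_nonneg _) ?_
    rcases hcase with h1 | h1
    · simp [h1]
    · exact h1.le
  · rw [hd, ← mul_one_sub]
    refine mul_ne_zero h0 fun h1 => ?_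
    have h2 : S = 1 := (sub_eq_zero.1 h1).symm
    rcases hcase with h3 | h3 <;> simp [h2] at h3

namespace IsStable

variable {p : MvPolynomial σ ℝ}

lemma lineRestrict_eval_ne_zero (hp : IsStable p) {z : σ → ℂ} (hz : ∀ a, 0 < (z a).im)
    {w : σ → ℝ} (hw : 0 ≤ w) (s : ℂ) (hs : 0 ≤ s.im) : (lineRestrict z w p).eval s ≠ 0 := by
  rw [eval_lineRestrict]
  refine hp _ fun a => ?_
  have := mul_nonneg hs (hw a)
  have := hz a
  simp
  linarith

/-- Stability is preserved by the operators `1 - D_w` with `w ≥ 0`. -/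
lemma sub_dirDeriv (hp : IsStable p) {w : σ → ℝ} (hw : 0 ≤ w) :
    IsStable (p - dirDeriv w p) := by
  intro z hz
  have := (logDeriv_zero_of_eval_ne_zero (hp.lineRestrict_eval_ne_zero hz hw)).2
  rw [derivative_lineRestrict, eval_lineRestrict, eval_lineRestrict] at this
  simpa using this

lemma im_dirDeriv_mul_conj_le_zero (hp : IsStable p) {z : σ → ℂ} (hz : ∀ a, 0 ≤ (z a).im)
    {w : σ → ℝ} (hw : 0 ≤ w) :
    (MvPolynomial.aeval z (dirDeriv w p) * conj (MvPolynomial.aeval z p)).im ≤ 0 := by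
  have hcont : ∀ q : MvPolynomial σ ℝ,
      Continuous fun ε : ℝ => MvPolynomial.aeval (fun a => z a + ε * Complex.I) q := by
    intro q
    simp only [MvPolynomial.aeval_def, MvPolynomial.eval₂_eq_eval_map]
    exact (MvPolynomial.continuous_eval _).comp (by fun_prop)
  have hc : Continuous fun ε : ℝ =>
      (MvPolynomial.aeval (fun a => z a + ε * Complex.I) (dirDeriv w p) *
        conj (MvPolynomial.aeval (fun a => z a + ε * Complex.I) p)).im :=
    Complex.continuous_im.comp ((hcont _).mul (Complex.continuous_conj.comp (hcont _)))
  have ht := (hc.tendsto 0).mono_left (nhdsWithin_le_nhds (s := Set.Ioi 0))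
  simp only [Complex.ofReal_zero, zero_mul, add_zero] at ht
  refine le_of_tendsto ht ?_
  filter_upwards [self_mem_nhdsWithin] with ε (hε : 0 < ε)
  have hz' : ∀ a, 0 < ((fun a => z a + ε * Complex.I) a).im := fun a => by
    have := hz a
    simp; linarith
  have := (logDeriv_zero_of_eval_ne_zero (hp.lineRestrict_eval_ne_zero hz' hw)).1
  rw [derivative_lineRestrict, eval_lineRestrict, eval_lineRestrict] at this
  simpa using this

lemma pickPair_lineRestrict (hp : IsStable p) (y : σ → ℝ) {v w : σ → ℝ} (hv : 0 ≤ v)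
    (hw : 0 ≤ w) : PickPair (lineRestrict y v p) (lineRestrict y v (dirDeriv w p)) := by
  intro z hz
  rw [aeval_lineRestrict_real, aeval_lineRestrict_real]
  refine hp.im_dirDeriv_mul_conj_le_zero (fun a => ?_) hw
  simpa using mul_nonneg hz.le (hv a)

lemma aeval_lineRestrict_ne_zero (hp : IsStable p) {y v : σ → ℝ} (hv : 0 ≤ v)
    (h0 : lineRestrict y v p ≠ 0) {z : ℂ} (hz : 0 < z.im) : aeval z (lineRestrict y v p) ≠ 0 := by
  rw [aeval_eq_eval_map]
  refine eval_ne_zero_of_im_derivative_mul_conj_le_zero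
    ((Polynomial.map_ne_zero_iff (algebraMap ℝ ℂ).injective).2 h0) (fun z hz => ?_) hz
  rw [derivative_map, ← aeval_eq_eval_map, ← aeval_eq_eval_map, derivative_lineRestrict,
    aeval_lineRestrict_real, aeval_lineRestrict_real]
  refine hp.im_dirDeriv_mul_conj_le_zero (fun a => ?_) hv
  simpa using mul_nonneg hz (hv a)

end IsStable

lemma IsAbove.pos {p : MvPolynomial σ ℝ} {y : σ → ℝ} (h : IsAbove p y) :
    0 < MvPolynomial.eval y p := by
  simpa using h 0 le_rfl

lemma IsAbove.add {p : MvPolynomial σ ℝ} {y t : σ → ℝ} (h : IsAbove p y) (ht : 0 ≤ t) :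
    IsAbove p (y + t) := fun t' ht' => by
  rw [add_assoc]; exact h _ (add_nonneg ht ht')

lemma IsAbove.mono {p : MvPolynomial σ ℝ} {y y' : σ → ℝ} (h : IsAbove p y) (hy : y ≤ y') :
    IsAbove p y' := by
  simpa using h.add (sub_nonneg.2 hy)

lemma IsAbove.eval_lineRestrict_pos {p : MvPolynomial σ ℝ} {y v : σ → ℝ} (h : IsAbove p y)
    (hv : 0 ≤ v) {s : ℝ} (hs : 0 ≤ s) : 0 < (lineRestrict y v p).eval s := by
  rw [eval_lineRestrict_real]
  exact h _ (smul_nonneg hs hv)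

lemma IsAbove.lineRestrict_ne_zero {p : MvPolynomial σ ℝ} {y v : σ → ℝ} (h : IsAbove p y)
    (hv : 0 ≤ v) : lineRestrict y v p ≠ 0 := by
  intro h0
  have := h.eval_lineRestrict_pos hv (s := 0) le_rfl
  simp [h0] at this

/-- Potentials decrease when the point moves up. -/
lemma IsStable.potential_add_le {p : MvPolynomial σ ℝ} (hp : IsStable p) {y t w : σ → ℝ}
    (h : IsAbove p y) (ht : 0 ≤ t) (hw : 0 ≤ w) :
    potential w p (y + t) ≤ potential w p y := by
  have h0 := h.lineRestrict_ne_zero ht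
  have := (hp.pickPair_lineRestrict y ht hw).div_antitone h0
    (fun z hz => hp.aeval_lineRestrict_ne_zero ht h0 hz) (a := 0) (b := 1)
    (fun x hx => h.eval_lineRestrict_pos ht hx) zero_le_one
  simpa [potential, eval_lineRestrict_real] using this

lemma tendsto_potential_add_smul {p : MvPolynomial σ ℝ} {y w : σ → ℝ}
    (h : IsAbove p y) (hw : 0 ≤ w) :
    Tendsto (fun s : ℝ => potential w p (y + s • w)) atTop (𝓝 0) := by
  have := div_tendsto_atTop_zero_of_degree_lt _ _
    (degree_derivative_lt (h.lineRestrict_ne_zero hw))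
  simpa only [potential, derivative_lineRestrict, eval_lineRestrict_real] using this

lemma IsStable.potential_nonneg {p : MvPolynomial σ ℝ} (hp : IsStable p) {y w : σ → ℝ}
    (h : IsAbove p y) (hw : 0 ≤ w) : 0 ≤ potential w p y := by
  refine le_of_tendsto (tendsto_potential_add_smul h hw) ?_
  filter_upwards [eventually_ge_atTop 0] with s hs
  exact hp.potential_add_le h (smul_nonneg hs hw) hw

/-- If the potential in direction `v` is less than `1`, then `1 - D_v` creates no zeros above. -/
lemma IsStable.isAbove_sub_dirDeriv {p : MvPolynomial σ ℝ} (hp : IsStable p) {y v : σ → ℝ}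
    (h : IsAbove p y) (hv : 0 ≤ v) (h1 : potential v p y < 1) :
    IsAbove (p - dirDeriv v p) y := by
  intro t ht
  have h2 := (hp.potential_add_le h ht hv).trans_lt h1
  rw [potential, div_lt_one (h t ht)] at h2
  rw [map_sub]
  linarith

lemma IsStable.exists_isAbove_sub_dirDeriv {p : MvPolynomial σ ℝ} (hp : IsStable p)
    {v : σ → ℝ} (h : ∃ y, IsAbove p y) (hv : 0 ≤ v) : ∃ y, IsAbove (p - dirDeriv v p) y := by
  obtain ⟨y, hy⟩ := h
  obtain ⟨s, hs, hs0⟩ := (((tendsto_potential_add_smul hy hv).eventually_lt_const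
    zero_lt_one).and (eventually_ge_atTop 0)).exists
  exact ⟨_, hp.isAbove_sub_dirDeriv (hy.add (smul_nonneg hs0 hv)) hv hs⟩

/-- The barrier step: if the potential in direction `v` is at most `1 - 1/δ`, then applying
`1 - D_v` and moving by `δ v` stays above the zeros and does not increase any potential. -/
lemma IsStable.barrier {p : MvPolynomial σ ℝ} (hp : IsStable p) {y v : σ → ℝ}
    (h : IsAbove p y) (hv : 0 ≤ v) {δ : ℝ} (hδ : 0 < δ) (hpot : potential v p y ≤ 1 - 1 / δ) :
    IsAbove (p - dirDeriv v p) (y + δ • v) ∧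
      ∀ w, 0 ≤ w → potential w (p - dirDeriv v p) (y + δ • v) ≤ potential w p y := by
  have hδv : 0 ≤ δ • v := smul_nonneg hδ.le hv
  have hδ' : 0 < 1 / δ := by positivity
  have hb := (hp.potential_add_le h hδv hv).trans hpot
  have habove := h.add hδv
  refine ⟨hp.isAbove_sub_dirDeriv habove hv (by linarith), fun w hw => ?_⟩
  have h0 := h.lineRestrict_ne_zero hv
  obtain ⟨e1, e2⟩ := (hp.pickPair_lineRestrict y hv hw).tangent_le h0
    (fun z hz => hp.aeval_lineRestrict_ne_zero hv h0 hz) (a := 0) (b := δ)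
    (fun x hx => h.eval_lineRestrict_pos hv hx) hδ.le
  simp only [derivative_lineRestrict, eval_lineRestrict_real, zero_smul, add_zero, sub_zero]
    at e1 e2
  have hP := habove.pos
  unfold potential at hb ⊢
  refine le_trans ?_ e2
  rw [map_sub, map_sub, map_sub, dirDeriv_comm w v]
  set P := MvPolynomial.eval (y + δ • v) p
  set a := MvPolynomial.eval (y + δ • v) (dirDeriv w p)
  set b := MvPolynomial.eval (y + δ • v) (dirDeriv v p)
  set c := MvPolynomial.eval (y + δ • v) (dirDeriv v (dirDeriv w p))
  have hPb : P / δ ≤ P - b := by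
    rw [div_le_iff₀ hP] at hb
    have : P / δ = 1 / δ * P := by ring
    linarith
  have hPb0 : 0 < P - b := lt_of_lt_of_le (by positivity) hPb
  have e3 : (a - c) / (P - b) = a / P + (a * b - c * P) / (P * (P - b)) := by
    field_simp; ring
  have e4 : (a * b - c * P) / (P * (P - b)) ≤ (a * b - c * P) / (P * (P / δ)) :=
    div_le_div_of_nonneg_left (by linarith) (by positivity) (by gcongr)
  have e5 : (a * b - c * P) / (P * (P / δ)) = - (δ * ((c * P - a * b) / P ^ 2)) := by
    field_simp; ring
  rw [e3]
  linarith

/-- Zeros of `p` do not lie above those of `(1 - D_v) p`: at the largest zero of `p` on a line in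
direction `(1, …, 1)`, the derivative `D_v p` is nonnegative, so `(1 - D_v) p` is not positive. -/
lemma IsStable.isAbove_of_isAbove_sub_dirDeriv {p : MvPolynomial σ ℝ} (hp : IsStable p)
    [Finite σ] {v y : σ → ℝ} (hv : 0 ≤ v) (hex : ∃ y, IsAbove p y)
    (h : IsAbove (p - dirDeriv v p) y) : IsAbove p y := by
  obtain ⟨y₀, hy₀⟩ := hex
  intro t ht
  by_contra! hneg
  -- restrict to the line from `y + t` in direction `(1, …, 1)`
  have h1 : (0 : σ → ℝ) ≤ 1 := zero_le_one
  obtain ⟨s₀, hs₀, hle⟩ : ∃ s₀ : ℝ, 0 ≤ s₀ ∧ y₀ ≤ y + t + s₀ • 1 := by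
    cases nonempty_fintype σ
    refine ⟨∑ a, |y₀ a - (y + t) a|, Finset.sum_nonneg fun _ _ => abs_nonneg _, fun a => ?_⟩
    have := Finset.single_le_sum (f := fun a => |y₀ a - (y + t) a|) (fun _ _ => abs_nonneg _)
      (Finset.mem_univ a)
    have h2 := le_abs_self (y₀ a - (y + t) a)
    simp at this h2 ⊢
    linarith
  set f := lineRestrict (y + t) 1 p with hf
  set g := lineRestrict (y + t) 1 (dirDeriv v p) with hg
  have habove := hy₀.mono hle
  have hfpos : ∀ s, s₀ ≤ s → 0 < f.eval s := fun s hs => by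
    rw [hf, eval_lineRestrict_real]
    have := habove (((s - s₀) : ℝ) • 1) (smul_nonneg (sub_nonneg.2 hs) h1)
    rwa [add_assoc, ← add_smul, add_sub_cancel] at this
  have hf0 : f ≠ 0 := fun h0 => by
    have := hfpos s₀ le_rfl
    simp [h0] at this
  -- the largest zero of `f`
  have hroot : ∃ s, 0 ≤ s ∧ f.IsRoot s := by
    have hf0' : f.eval 0 ≤ 0 := by
      rw [hf, eval_lineRestrict_real]; simpa using hneg
    obtain ⟨s, hs, hs'⟩ := intermediate_value_Icc hs₀ f.continuous.continuousOn
      ⟨hf0', (hfpos s₀ le_rfl).le⟩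
    exact ⟨s, hs.1, hs'⟩
  obtain ⟨s₁, hs₁, hmax⟩ : ∃ s₁, f.IsRoot s₁ ∧ ∀ s, f.IsRoot s → s ≤ s₁ := by
    obtain ⟨s, -, hs⟩ := hroot
    have hne : f.roots.toFinset.Nonempty := ⟨s, by simp [hf0, hs.eq_zero]⟩
    refine ⟨f.roots.toFinset.max' hne, ?_, fun s' hs' => Finset.le_max' _ _ ?_⟩
    · have := Finset.max'_mem _ hne
      rw [Multiset.mem_toFinset] at this
      exact (mem_roots'.1 this).2
    · simp [hf0, hs'.eq_zero]
  have hs₁0 : 0 ≤ s₁ := by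
    obtain ⟨s, h0, hs⟩ := hroot
    exact h0.trans (hmax s hs)
  have hs₁s₀ : s₁ < s₀ := by
    by_contra! hc
    exact (hfpos s₁ hc).ne' hs₁
  have hfpos' : ∀ s, s₁ < s → 0 < f.eval s := by
    intro s hs
    by_contra! hc
    have hlt : s < s₀ := by
      by_contra! hc'
      exact (hfpos s hc').not_ge hc
    obtain ⟨s', hs', hs''⟩ := intermediate_value_Icc hlt.le f.continuous.continuousOn
      ⟨hc, (hfpos s₀ le_rfl).le⟩
    have := hmax s' hs''
    linarith [hs'.1]
  -- between `s₁` and `s₀` the quotient `g / f` is at least its nonnegative value at `s₀`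
  have hgpos : ∀ s ∈ Set.Ioc s₁ s₀, 0 ≤ g.eval s := by
    intro s hs
    have h2 := (hp.pickPair_lineRestrict (y + t) h1 hv).div_antitone hf0
      (fun z hz => hp.aeval_lineRestrict_ne_zero h1 hf0 hz) (a := s) (b := s₀)
      (fun x hx => hfpos' x (hs.1.trans_le hx)) hs.2
    have h3 := hp.potential_nonneg habove hv
    rw [potential, ← eval_lineRestrict_real, ← eval_lineRestrict_real] at h3
    have h4 := h3.trans h2
    have h5 : 0 ≤ g.eval s / f.eval s * f.eval s := mul_nonneg h4 (hfpos' s hs.1).le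
    rwa [div_mul_cancel₀ _ (hfpos' s hs.1).ne'] at h5
  have hgs₁ : 0 ≤ g.eval s₁ := by
    have ht := (g.continuous.tendsto s₁).mono_left (nhdsWithin_le_nhds (s := Set.Ioi s₁))
    refine ge_of_tendsto ht ?_
    filter_upwards [Ioc_mem_nhdsGT hs₁s₀] with s hs using hgpos s hs
  have h6 := h (t + s₁ • 1) (add_nonneg ht (smul_nonneg hs₁0 h1))
  rw [map_sub, ← add_assoc, ← eval_lineRestrict_real, ← eval_lineRestrict_real, ← hf, ← hg,
    hs₁.eq_zero] at h6
  linarith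

/-- The averaging step of the interlacing argument: if `v` is the average of the `u j` and `y` is
above the zeros of `(1 - D_v) p`, then `y` is above the zeros of some `(1 - D_(u j)) p`. -/
lemma IsStable.exists_isAbove_of_average {ι : Type*} [Fintype ι] [Nonempty ι] [Finite σ]
    {p : MvPolynomial σ ℝ} (hp : IsStable p) (hex : ∃ y, IsAbove p y) {u : ι → σ → ℝ}
    (hu : ∀ j, 0 ≤ u j) {v y : σ → ℝ} (hv : ∑ j, u j = (Fintype.card ι : ℝ) • v)
    (h : IsAbove (p - dirDeriv v p) y) : ∃ j, IsAbove (p - dirDeriv (u j) p) y := by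
  have hcard : (0 : ℝ) < Fintype.card ι := by exact_mod_cast Fintype.card_pos
  have hv0 : 0 ≤ v := by
    have : v = (Fintype.card ι : ℝ)⁻¹ • ∑ j, u j := by rw [hv, inv_smul_smul₀ hcard.ne']
    rw [this]
    exact smul_nonneg (by positivity) (Finset.sum_nonneg fun j _ => hu j)
  have hab := hp.isAbove_of_isAbove_sub_dirDeriv hv0 hex h
  have h1 := h.pos
  rw [map_sub] at h1
  have hsum : ∑ j, MvPolynomial.eval y (dirDeriv (u j) p) <
      ∑ _j : ι, MvPolynomial.eval y p := by
    rw [← map_sum, ← dirDeriv_sum, hv, dirDeriv_smul, MvPolynomial.smul_eval, Finset.sum_const,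
      Finset.card_univ, nsmul_eq_mul]
    gcongr
    linarith
  obtain ⟨j, -, hj⟩ := Finset.exists_lt_of_sum_lt hsum
  exact ⟨j, hp.isAbove_sub_dirDeriv hab (hu j) ((div_lt_one hab.pos).2 hj)⟩

/-- Successive application of the operators `1 - D_(v i)` for `i` in a list. -/
noncomputable def subDirDerivs {ι : Type*} (v : ι → σ → ℝ) (l : List ι)
    (p : MvPolynomial σ ℝ) : MvPolynomial σ ℝ :=
  l.foldr (fun i q => q - dirDeriv (v i) q) p

section
variable {ι : Type*} (v : ι → σ → ℝ)

@[simp] lemma subDirDerivs_nil (p : MvPolynomial σ ℝ) : subDirDerivs v [] p = p := rfl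

@[simp] lemma subDirDerivs_cons (i : ι) (l : List ι) (p : MvPolynomial σ ℝ) :
    subDirDerivs v (i :: l) p = subDirDerivs v l p - dirDeriv (v i) (subDirDerivs v l p) := rfl

lemma subDirDerivs_sub_dirDeriv (w : σ → ℝ) (l : List ι) (p : MvPolynomial σ ℝ) :
    subDirDerivs v l (p - dirDeriv w p) =
      subDirDerivs v l p - dirDeriv w (subDirDerivs v l p) := by
  induction l with
  | nil => rfl
  | cons i l ih =>
    rw [subDirDerivs_cons, ih, subDirDerivs_cons]
    simp only [map_sub]
    rw [dirDeriv_comm w (v i)]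
    abel

variable {v}

lemma subDirDerivs_congr {v' : ι → σ → ℝ} {l : List ι} (h : ∀ i ∈ l, v i = v' i)
    (p : MvPolynomial σ ℝ) : subDirDerivs v l p = subDirDerivs v' l p := by
  induction l with
  | nil => rw [subDirDerivs_nil, subDirDerivs_nil]
  | cons i l ih =>
    rw [subDirDerivs_cons, subDirDerivs_cons, ih fun i' hi' => h i' (List.mem_cons_of_mem _ hi'),
      h i List.mem_cons_self]

lemma IsStable.isStable_subDirDerivs {p : MvPolynomial σ ℝ} (hp : IsStable p) (hv : ∀ i, 0 ≤ v i)
    (hex : ∃ y, IsAbove p y) (l : List ι) :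
    IsStable (subDirDerivs v l p) ∧ ∃ y, IsAbove (subDirDerivs v l p) y := by
  induction l with
  | nil => exact ⟨hp, hex⟩
  | cons i l ih =>
    exact ⟨ih.1.sub_dirDeriv (hv i), ih.1.exists_isAbove_sub_dirDeriv ih.2 (hv i)⟩

/-- Iterated barrier step. -/
lemma IsStable.isAbove_subDirDerivs {p : MvPolynomial σ ℝ} (hp : IsStable p)
    (hv : ∀ i, 0 ≤ v i) {y : σ → ℝ} (h : IsAbove p y) {δ : ℝ} (hδ : 0 < δ)
    (hpot : ∀ i, potential (v i) p y ≤ 1 - 1 / δ) (l : List ι) :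
    IsAbove (subDirDerivs v l p) (y + δ • (l.map v).sum) := by
  suffices IsAbove (subDirDerivs v l p) (y + δ • (l.map v).sum) ∧
      ∀ w, 0 ≤ w → potential w (subDirDerivs v l p) (y + δ • (l.map v).sum) ≤
        potential w p y from this.1
  induction l with
  | nil => simpa using h
  | cons i l ih =>
    obtain ⟨b1, b2⟩ := (hp.isStable_subDirDerivs hv ⟨y, h⟩ l).1.barrier ih.1 (hv i) hδ
      ((ih.2 _ (hv i)).trans (hpot i))
    have e : y + δ • ((i :: l).map v).sum = y + δ • (l.map v).sum + δ • v i := by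
      rw [List.map_cons, List.sum_cons, smul_add]; abel
    rw [e]
    exact ⟨b1, fun w hw => (b2 w hw).trans (ih.2 w hw)⟩

/-- Averages of the directions can be replaced one after another by suitable choices. -/
lemma IsStable.exists_choice {κ : Type*} [Fintype κ] [Nonempty κ] [Finite σ]
    {u : ι → κ → σ → ℝ} (hu : ∀ i j, 0 ≤ u i j)
    (hv : ∀ i, 0 ≤ v i) (huv : ∀ i, ∑ j, u i j = (Fintype.card κ : ℝ) • v i) {y : σ → ℝ}
    (l : List ι) (hl : l.Nodup) {p : MvPolynomial σ ℝ} (hp : IsStable p)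
    (hex : ∃ y, IsAbove p y) (h : IsAbove (subDirDerivs v l p) y) :
    ∃ c : ι → κ, IsAbove (subDirDerivs (fun i => u i (c i)) l p) y := by
  classical
  induction l generalizing p with
  | nil => exact ⟨fun _ => Classical.arbitrary κ, by
    rw [subDirDerivs_nil] at h ⊢
    exact h⟩
  | cons i l ih =>
    obtain ⟨hi, hl'⟩ := List.nodup_cons.1 hl
    obtain ⟨h1, h2⟩ := hp.isStable_subDirDerivs hv hex l
    rw [subDirDerivs_cons] at h
    obtain ⟨j, hj⟩ : ∃ j, IsAbove (subDirDerivs v l p - dirDeriv (u i j) (subDirDerivs v l p)) y :=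
      IsStable.exists_isAbove_of_average (u := u i) (v := v i) h1 h2 (hu i) (huv i) h
    rw [← subDirDerivs_sub_dirDeriv] at hj
    obtain ⟨c, hc⟩ := ih hl' (hp.sub_dirDeriv (hu i j)) (hp.exists_isAbove_sub_dirDeriv hex (hu i j))
      hj
    refine ⟨Function.update c i j, ?_⟩
    have hcong := subDirDerivs_congr (v := fun i' => u i' (Function.update c i j i'))
      (v' := fun i' => u i' (c i')) (l := l)
      (fun i' hi' => by
        have hne : i' ≠ i := by rintro rfl; exact hi hi'
        simp only [Function.update_of_ne hne]) p
    rw [subDirDerivs_cons, hcong, Function.update_self]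
    rw [subDirDerivs_sub_dirDeriv] at hc
    exact hc

end

/-! ### Matrices of rank one and determinants -/

section
open Matrix
open scoped MatrixOrder

variable {n : Type*} [Fintype n] [DecidableEq n]

lemma Matrix.PosSemidef.exists_eq_vecMulVec_of_rank_eq_one {A : Matrix n n ℂ} (hA : A.PosSemidef)
    (hr : A.rank = 1) : ∃ v : n → ℂ, A = vecMulVec v (star v) := by
  obtain ⟨B, hB⟩ := CStarAlgebra.nonneg_iff_eq_star_mul_self.mp hA.nonneg
  rw [star_eq_conjTranspose] at hB
  have hBr : B.rank = 1 := by rw [← hr, hB, rank_conjTranspose_mul_self]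
  obtain ⟨x, -, hx⟩ := finrank_eq_one_iff'.1 (show Module.finrank ℂ B.mulVecLin.range = 1 from hBr)
  choose c hc using fun j => hx ⟨B.mulVecLin (Pi.single j 1), LinearMap.mem_range_self _ _⟩
  have hBv : B = vecMulVec (x : n → ℂ) c := by
    ext i j
    have := congrFun (congrArg Subtype.val (hc j)) i
    simp at this
    rw [vecMulVec_apply, ← this, mul_comm]
  have hρ : (star (x : n → ℂ) ⬝ᵥ (x : n → ℂ)) = ((∑ i, ‖(x : n → ℂ) i‖ ^ 2 : ℝ) : ℂ) := by
    simp only [dotProduct, Pi.star_apply, RCLike.star_def, Complex.conj_mul']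
    push_cast; rfl
  set ρ := ∑ i, ‖(x : n → ℂ) i‖ ^ 2
  have hρ0 : 0 ≤ ρ := Finset.sum_nonneg fun _ _ => by positivity
  refine ⟨(√ρ : ℂ) • star c, ?_⟩
  rw [hB, hBv, conjTranspose_vecMulVec, vecMulVec_mul_vecMulVec, hρ]
  ext i j
  have h2 : ((√ρ : ℝ) : ℂ) * ((√ρ : ℝ) : ℂ) = ρ := by
    rw [← Complex.ofReal_mul, Real.mul_self_sqrt hρ0]
  simp [vecMulVec_apply]
  linear_combination (-(conj (c i) * c j)) * h2

/-- The determinant is affine along rank-one perturbations. -/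
lemma Matrix.det_add_smul_vecMulVec {R : Type*} [CommRing R] (M : Matrix n n R) (v w : n → R)
    (s : R) : (M + s • vecMulVec v w).det = M.det + s * ((M + vecMulVec v w).det - M.det) := by
  -- the perturbation parameter enters only the last row of a bordered matrix
  have key : ∀ s : R, (M + s • vecMulVec v w).det =
      s * ((fromBlocks M (replicateCol Unit v) 0 1).updateRow (Sum.inr ())
        (Sum.elim (-w) (0 : Unit → R))).det +
      ((fromBlocks M (replicateCol Unit v) 0 1).updateRow (Sum.inr ())
        (Sum.elim (0 : n → R) (1 : Unit → R))).det := by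
    intro s
    rw [← det_updateRow_smul, ← det_updateRow_add]
    have : (fromBlocks M (replicateCol Unit v) 0 1).updateRow (Sum.inr ())
        (s • Sum.elim (-w) (0 : Unit → R) + Sum.elim (0 : n → R) (1 : Unit → R)) =
        fromBlocks M (replicateCol Unit v) (replicateRow Unit (-(s • w))) 1 := by
      ext i j
      rcases i with i | ⟨⟩ <;> rcases j with j | ⟨⟩ <;> simp [updateRow_apply]
    rw [this, det_fromBlocks_one₂₂]
    congr 1
    ext i j
    simp [mul_apply, vecMulVec_apply]
    ring
  have h0 := key 0
  have h1 := key 1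
  rw [zero_smul, add_zero] at h0
  rw [one_smul] at h1
  rw [key s, h0, h1]
  ring

lemma Matrix.det_smul_one_add_smul_vecMulVec (v w : n → ℂ) {t : ℂ} (ht : t ≠ 0) (s : ℂ) :
    (t • (1 : Matrix n n ℂ) + s • vecMulVec v w).det =
      t ^ Fintype.card n * (1 + s / t * (w ⬝ᵥ v)) := by
  have : t • (1 : Matrix n n ℂ) + s • vecMulVec v w =
      t • (1 + replicateCol Unit ((s / t) • v) * replicateRow Unit w) := by
    ext i j
    simp [mul_apply, vecMulVec_apply]
    field_simp
  rw [this, det_smul, det_one_add_mul_comm, det_unique]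
  congr 2
  simp [mul_apply, dotProduct, Finset.mul_sum, mul_left_comm]

/-- The squared length of `v` is at most the norm of `v vᴴ`. -/
lemma Matrix.dotProduct_le_of_norm_vecMulVec_le {v : n → ℂ} {C : ℝ} (hC : 0 ≤ C)
    (h : ‖vecMulVec v (star v)‖ ≤ C) :
    ∃ τ : ℝ, 0 ≤ τ ∧ τ ≤ C ∧ star v ⬝ᵥ v = τ := by
  have hρ : star v ⬝ᵥ v = ((∑ i, ‖v i‖ ^ 2 : ℝ) : ℂ) := by
    simp only [dotProduct, Pi.star_apply, RCLike.star_def, Complex.conj_mul']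
    push_cast; rfl
  set τ := ∑ i, ‖v i‖ ^ 2
  have hτ0 : 0 ≤ τ := Finset.sum_nonneg fun _ _ => by positivity
  refine ⟨τ, hτ0, ?_, hρ⟩
  have hpsd : (vecMulVec v (star v)).PosSemidef := posSemidef_vecMulVec_self_star v
  have h1 := (CStarAlgebra.norm_le_iff_le_algebraMap _ hC hpsd.nonneg).1 h
  rw [Matrix.le_iff] at h1
  have h2 := h1.dotProduct_mulVec_nonneg v
  have h3 : star v ⬝ᵥ (algebraMap ℝ (Matrix n n ℂ) C - vecMulVec v (star v)) *ᵥ v =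
      ((C * τ - τ * τ : ℝ) : ℂ) := by
    rw [Matrix.sub_mulVec, dotProduct_sub, Algebra.algebraMap_eq_smul_one, Matrix.smul_mulVec,
      one_mulVec, vecMulVec_mulVec, dotProduct_smul, dotProduct_smul, hρ]
    simp
  rw [h3, Complex.zero_le_real] at h2
  by_contra! hlt
  nlinarith

/-- A positive semidefinite matrix whose characteristic polynomial has no zeros beyond `μ` has norm
at most `μ`. -/
lemma Matrix.PosSemidef.norm_le_of_det_ne_zero {A : Matrix n n ℂ} (hA : A.PosSemidef) {μ : ℝ}
    (hμ : 0 ≤ μ) (h : ∀ x : ℝ, μ ≤ x → ((x : ℂ) • (1 : Matrix n n ℂ) - A).det ≠ 0) : ‖A‖ ≤ μ := by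
  rw [CStarAlgebra.norm_le_iff_le_algebraMap A hμ hA.nonneg]
  refine le_algebraMap_of_spectrum_le (fun x hx => ?_) hA.isHermitian.isSelfAdjoint
  by_contra! hlt
  refine hx ?_
  rw [spectrum.mem_resolventSet_iff, Matrix.isUnit_iff_isUnit_det, isUnit_iff_ne_zero]
  have : algebraMap ℝ (Matrix n n ℂ) x = (x : ℂ) • (1 : Matrix n n ℂ) := by
    rw [Algebra.algebraMap_eq_smul_one]
    ext i j; simp [Matrix.smul_apply]
  rw [this]
  exact h x hlt.le

lemma Matrix.norm_sum_le_norm_sum_of_subset {ι : Type*} {A : ι → Matrix n n ℂ}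
    (hA : ∀ i, (A i).PosSemidef) {s t : Finset ι} (hst : s ⊆ t) :
    ‖∑ i ∈ s, A i‖ ≤ ‖∑ i ∈ t, A i‖ :=
  CStarAlgebra.norm_le_norm_of_nonneg_of_le (Finset.sum_nonneg fun i _ => (hA i).nonneg)
    (Finset.sum_le_sum_of_subset_of_nonneg hst fun i _ _ => (hA i).nonneg)

/-- A positive combination of positive semidefinite matrices with sum `1` is positive definite. -/
lemma Matrix.posDef_sum_smul {k ι : Type*} [DecidableEq k] [Fintype ι] {A : ι → Matrix k k ℂ}
    (hA : ∀ i, (A i).PosSemidef) (hsum : ∑ i, A i = 1) {t : ℝ} (ht : 0 < t) {y : ι → ℝ}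
    (hy : ∀ i, t ≤ y i) : (∑ i, (y i : ℂ) • A i).PosDef := by
  have : ∑ i, (y i : ℂ) • A i = (t : ℂ) • 1 + ∑ i, ((y i - t : ℝ) : ℂ) • A i := by
    rw [← hsum, Finset.smul_sum, ← Finset.sum_add_distrib]
    refine Finset.sum_congr rfl fun i _ => ?_
    rw [← add_smul]; push_cast; ring_nf
  rw [this]
  refine PosDef.add_posSemidef (PosDef.one.smul (by exact_mod_cast ht))
    (posSemidef_sum _ fun i _ => (hA i).smul ?_)
  exact_mod_cast sub_nonneg.2 (hy i)

/-- A combination of positive semidefinite matrices with sum `1` whose coefficients lie in the open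
upper half-plane is invertible. -/
lemma Matrix.det_sum_smul_ne_zero {ι : Type*} [Fintype ι] {A : ι → Matrix n n ℂ}
    (hA : ∀ i, (A i).PosSemidef) (hsum : ∑ i, A i = 1) {z : ι → ℂ} (hz : ∀ i, 0 < (z i).im) :
    (∑ i, z i • A i).det ≠ 0 := by
  intro h0
  obtain ⟨x, hx0, hx⟩ := Matrix.exists_mulVec_eq_zero_iff.2 h0
  have hq : ∀ i, 0 ≤ star x ⬝ᵥ (A i *ᵥ x) := fun i => (hA i).dotProduct_mulVec_nonneg x
  have h1 : ∑ i, z i * (star x ⬝ᵥ (A i *ᵥ x)) = 0 := by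
    have := congrArg (star x ⬝ᵥ ·) hx
    simpa [Matrix.sum_mulVec, dotProduct_sum, Matrix.smul_mulVec] using this
  have h2 : ∑ i, (z i).im * (star x ⬝ᵥ (A i *ᵥ x)).re = 0 := by
    have := congrArg Complex.im h1
    rw [Complex.im_sum, Complex.zero_im] at this
    rw [← this]
    refine Finset.sum_congr rfl fun i _ => ?_
    have him := (Complex.nonneg_iff.1 (hq i)).2
    rw [Complex.mul_im, ← him]; ring
  rw [Finset.sum_eq_zero_iff_of_nonneg fun i _ =>
    mul_nonneg (hz i).le (Complex.nonneg_iff.1 (hq i)).1] at h2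
  have h3 : star x ⬝ᵥ x = 0 := by
    have : star x ⬝ᵥ x = ∑ i, star x ⬝ᵥ (A i *ᵥ x) := by
      rw [← dotProduct_sum, ← Matrix.sum_mulVec, hsum, one_mulVec]
    rw [this]
    refine Finset.sum_eq_zero fun i hi => Complex.ext ?_ (Complex.nonneg_iff.1 (hq i)).2.symm
    exact (mul_eq_zero.1 (h2 i hi)).resolve_left (hz i).ne'
  exact hx0 (dotProduct_star_self_eq_zero.1 h3)

end

/-! ### The determinantal polynomial of a decomposition of the identity -/

/-- A complex polynomial commuting with conjugation has real coefficients. -/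
lemma exists_real_of_eval_conj {Q : MvPolynomial σ ℂ}
    (h : ∀ z : σ → ℂ, MvPolynomial.eval (fun a => conj (z a)) Q = conj (MvPolynomial.eval z Q)) :
    ∃ P : MvPolynomial σ ℝ, ∀ z : σ → ℂ, MvPolynomial.aeval z P = MvPolynomial.eval z Q := by
  have hconj : ∀ (q : MvPolynomial σ ℂ) (z : σ → ℂ),
      MvPolynomial.eval z (MvPolynomial.map (starRingEnd ℂ) q) =
        conj (MvPolynomial.eval (fun a => conj (z a)) q) := by
    intro q z
    induction q using MvPolynomial.induction_on with
    | C a => simp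
    | add p q hp hq => simp only [map_add, hp, hq]
    | mul_X p a hp => rw [map_mul, map_mul, hp]; simp
  have hmap : MvPolynomial.map (starRingEnd ℂ) Q = Q := by
    refine MvPolynomial.funext fun z => ?_
    rw [hconj, h, Complex.conj_conj]
  obtain ⟨P, hP⟩ : Q ∈ Set.range (MvPolynomial.map (algebraMap ℝ ℂ)) := by
    rw [MvPolynomial.mem_range_map_iff_coeffs_subset]
    intro c hc
    obtain ⟨m, -, rfl⟩ := MvPolynomial.mem_coeffs_iff.1 hc
    have := congrArg (MvPolynomial.coeff m) hmap
    rw [MvPolynomial.coeff_map] at this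
    exact ⟨_, Complex.conj_eq_iff_re.1 this⟩
  refine ⟨P, fun z => ?_⟩
  rw [← hP, MvPolynomial.aeval_def, MvPolynomial.eval₂_eq_eval_map]

section
open Matrix

variable {n ι κ : Type*} [Fintype n] [DecidableEq n] [Fintype ι] [Fintype κ]

/-- `P` is the real polynomial `∏ j, det (∑ i, z (i, j) A i)`. -/
def IsDetPoly (A : ι → Matrix n n ℂ) (P : MvPolynomial (ι × κ) ℝ) : Prop :=
  ∀ z : ι × κ → ℂ, MvPolynomial.aeval z P = ∏ j, (∑ i, z (i, j) • A i).det

lemma exists_isDetPoly {A : ι → Matrix n n ℂ} (hA : ∀ i, (A i).IsHermitian) :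
    ∃ P : MvPolynomial (ι × κ) ℝ, IsDetPoly A P := by
  set Q : MvPolynomial (ι × κ) ℂ :=
    ∏ j : κ, (∑ i, MvPolynomial.X (R := ℂ) (i, j) • (A i).map MvPolynomial.C).det with hQ
  have hev : ∀ z : ι × κ → ℂ, MvPolynomial.eval z Q = ∏ j, (∑ i, z (i, j) • A i).det := by
    intro z
    rw [hQ, map_prod]
    refine Finset.prod_congr rfl fun j _ => ?_
    rw [RingHom.map_det]
    congr 1
    ext a b
    simp [Matrix.sum_apply]
  obtain ⟨P, hP⟩ := exists_real_of_eval_conj (Q := Q) fun z => by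
    rw [hev, hev, map_prod]
    refine Finset.prod_congr rfl fun j _ => ?_
    rw [starRingEnd_apply, ← det_conjTranspose, conjTranspose_sum]
    congr 1
    refine Finset.sum_congr rfl fun i _ => ?_
    rw [conjTranspose_smul, (hA i).eq]; rfl
  exact ⟨P, fun z => by rw [hP, hev]⟩

namespace IsDetPoly

variable {A : ι → Matrix n n ℂ} {P : MvPolynomial (ι × κ) ℝ}

lemma ofReal_eval (hP : IsDetPoly A P) (y : ι × κ → ℝ) :
    ((MvPolynomial.eval y P : ℝ) : ℂ) = ∏ j, (∑ i, (y (i, j) : ℂ) • A i).det := by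
  rw [← hP fun a => (y a : ℂ)]
  exact (MvPolynomial.aeval_algebraMap_apply ℂ y P).symm

lemma isStable (hP : IsDetPoly A P) (hA : ∀ i, (A i).PosSemidef) (hsum : ∑ i, A i = 1) :
    IsStable P := fun z hz => by
  rw [hP]
  exact Finset.prod_ne_zero_iff.2 fun j _ => Matrix.det_sum_smul_ne_zero hA hsum fun i => hz (i, j)

lemma isAbove (hP : IsDetPoly A P) (hA : ∀ i, (A i).PosSemidef) (hsum : ∑ i, A i = 1)
    {t : ℝ} (ht : 0 < t) : IsAbove P fun _ => t := by
  intro s hs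
  rw [← Complex.zero_lt_real, hP.ofReal_eval]
  refine Finset.prod_pos fun j _ => (Matrix.posDef_sum_smul hA hsum ht fun i => ?_).det_pos
  have := hs (i, j)
  simpa using this

variable [DecidableEq ι]

/-- The direction of simultaneous change of all variables belonging to the index `i`. -/
def rowDir (i : ι) : ι × κ → ℝ := fun a => if a.1 = i then 1 else 0

lemma potential_rowDir_le (hP : IsDetPoly A P) (hA : ∀ i, (A i).PosSemidef)
    (hrank : ∀ i, (A i).rank = 1) (hsum : ∑ i, A i = 1) {C : ℝ} (hC : 0 ≤ C)
    (hnorm : ∀ i, ‖A i‖ ≤ C) {t : ℝ} (ht : 0 < t) (i : ι) :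
    potential (rowDir i) P (fun _ => t) ≤ Fintype.card κ * C / t := by
  obtain ⟨v, hv⟩ := (hA i).exists_eq_vecMulVec_of_rank_eq_one (hrank i)
  obtain ⟨τ, hτ0, hτC, hτ⟩ := Matrix.dotProduct_le_of_norm_vecMulVec_le hC (hv ▸ hnorm i)
  set f := lineRestrict (fun _ => t) (rowDir (κ := κ) i) P with hf
  set N := Fintype.card n
  set r := Fintype.card κ
  have hfs : ∀ s : ℝ, f.eval s = (t ^ N * (1 + s / t * τ)) ^ r := by
    intro s
    rw [hf, eval_lineRestrict_real, ← Complex.ofReal_inj, hP.ofReal_eval]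
    set w : ι × κ → ℝ := (fun _ => t) + s • rowDir i with hw
    have : ∀ j : κ, ∑ i', (w (i', j) : ℂ) • A i' =
        (t : ℂ) • 1 + (s : ℂ) • A i := by
      intro j
      have h1 : ∀ i', (w (i', j) : ℂ) • A i' =
          (t : ℂ) • A i' + if i' = i then (s : ℂ) • A i' else 0 := by
        intro i'
        by_cases h : i' = i <;> simp [hw, rowDir, h, add_smul]
      simp only [h1]
      rw [Finset.sum_add_distrib, ← Finset.smul_sum, hsum, Finset.sum_ite_eq']
      simp
    simp only [this]
    rw [Finset.prod_const, Finset.card_univ, hv,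
      Matrix.det_smul_one_add_smul_vecMulVec _ _ (by exact_mod_cast ht.ne'), hτ]
    push_cast
    rfl
  have hder : f.derivative.eval 0 = r * (t ^ N) ^ (r - 1) * (t ^ N * (τ / t)) := by
    have h1 : HasDerivAt (fun s : ℝ => t ^ N * (1 + s / t * τ)) (t ^ N * (τ / t)) 0 := by
      have := ((((hasDerivAt_id (0 : ℝ)).div_const t).mul_const τ).const_add 1).const_mul (t ^ N)
      convert! this using 1
      ring
    have h2 := h1.pow r
    have h3 : (fun s => f.eval s) = (fun s : ℝ => t ^ N * (1 + s / t * τ)) ^ r := by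
      ext s; rw [hfs]; rfl
    have h4 := f.hasDerivAt 0
    rw [h3] at h4
    rw [h4.unique h2]
    simp
  have hpot : potential (rowDir i) P (fun _ => t) = r * τ / t := by
    have e0 : f.eval 0 = (t ^ N) ^ r := by rw [hfs]; simp
    rw [potential]
    have e1 := eval_lineRestrict_real (fun _ => t) (rowDir (κ := κ) i) P 0
    have e2 := eval_lineRestrict_real (fun _ => t) (rowDir (κ := κ) i) (dirDeriv (rowDir i) P) 0
    rw [← derivative_lineRestrict] at e2
    rw [zero_smul, add_zero] at e1 e2
    rw [← e1, ← e2, ← hf, e0, hder]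
    rcases Nat.eq_zero_or_pos r with h0 | h0
    · simp [h0]
    · obtain ⟨k, hk⟩ : ∃ k, r = k + 1 := ⟨r - 1, by omega⟩
      rw [hk, Nat.add_sub_cancel, pow_succ]
      field_simp
  rw [hpot]
  gcongr

/-- Along a single coordinate the determinantal polynomial of rank-one matrices is affine. -/
lemma affine_single [DecidableEq κ] (hP : IsDetPoly A P) (hA : ∀ i, (A i).PosSemidef)
    (hrank : ∀ i, (A i).rank = 1) (i : ι) (j : κ) (c : ℝ) (y : ι × κ → ℝ) :
    ∃ c₀ c₁ : ℝ, ∀ s : ℝ,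
      MvPolynomial.eval (y + s • Pi.single (i, j) c) P = c₀ + s * c₁ := by
  obtain ⟨v, hv⟩ := (hA i).exists_eq_vecMulVec_of_rank_eq_one (hrank i)
  obtain ⟨α, β, h⟩ : ∃ α β : ℂ, ∀ s : ℝ,
      ((MvPolynomial.eval (y + s • Pi.single (i, j) c) P : ℝ) : ℂ) = α + s * β := by
    set M := fun j' => ∑ i', (y (i', j') : ℂ) • A i' with hM
    refine ⟨(M j).det * ∏ j' ∈ Finset.univ.erase j, (M j').det,
      c * ((M j + A i).det - (M j).det) * ∏ j' ∈ Finset.univ.erase j, (M j').det, fun s => ?_⟩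
    set w : ι × κ → ℝ := y + s • Pi.single (i, j) c with hw
    have hs : ∀ j' : κ, ∑ i', (w (i', j') : ℂ) • A i' =
        if j' = j then M j + ((s * c : ℝ) : ℂ) • A i else M j' := by
      intro j'
      split_ifs with hj
      · subst hj
        have : ∀ i', (w (i', j') : ℂ) • A i' =
            (y (i', j') : ℂ) • A i' + if i' = i then ((s * c : ℝ) : ℂ) • A i' else 0 := by
          intro i'
          by_cases h : i' = i <;> simp [hw, h, add_smul]
        simp only [this]
        rw [Finset.sum_add_distrib, Finset.sum_ite_eq']
        simp [hM]
      · refine Finset.sum_congr rfl fun i' _ => ?_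
        simp [hw, hj]
    rw [hP.ofReal_eval]
    simp only [hs]
    rw [← Finset.mul_prod_erase _ _ (Finset.mem_univ j), if_pos rfl, hv,
      Matrix.det_add_smul_vecMulVec]
    have : ∏ x ∈ Finset.univ.erase j,
        (if x = j then M j + ((s * c : ℝ) : ℂ) • vecMulVec v (star v) else M x).det =
        ∏ j' ∈ Finset.univ.erase j, (M j').det :=
      Finset.prod_congr rfl fun x hx => by rw [if_neg (Finset.ne_of_mem_erase hx)]
    rw [this]
    push_cast
    ring
  refine ⟨α.re, β.re, fun s => ?_⟩
  have := congrArg Complex.re (h s)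
  simpa using this

end IsDetPoly

end

/-- If `P` is affine along every direction `u i`, each operator `1 - D_(u i)` acts on it as the
translation by `-u i`. -/
lemma eval_subDirDerivs_of_affine {ι : Type*} {u : ι → σ → ℝ} {P : MvPolynomial σ ℝ}
    (hP : ∀ i y, ∃ c₀ c₁ : ℝ, ∀ s : ℝ, MvPolynomial.eval (y + s • u i) P = c₀ + s * c₁)
    (l : List ι) (y : σ → ℝ) :
    MvPolynomial.eval y (subDirDerivs u l P) = MvPolynomial.eval (y - (l.map u).sum) P := by
  induction l generalizing y with
  | nil => simp
  | cons i l ih =>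
    rw [subDirDerivs_cons, map_sub]
    set q := subDirDerivs u l P
    set S := (l.map u).sum with hS
    obtain ⟨c₀, c₁, hc⟩ := hP i (y - S)
    have hf : lineRestrict y (u i) q = C c₀ + C c₁ * X := by
      refine Polynomial.funext fun s => ?_
      rw [eval_lineRestrict_real, ih, add_sub_right_comm, hc]
      simp only [eval_add, eval_mul, eval_C, eval_X, mul_comm]
    have e1 : MvPolynomial.eval y q = c₀ := by
      have := eval_lineRestrict_real y (u i) q 0
      rw [hf] at this
      simpa using this.symm
    have e2 : MvPolynomial.eval y (dirDeriv (u i) q) = c₁ := by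
      have := eval_lineRestrict_real y (u i) (dirDeriv (u i) q) 0
      rw [← derivative_lineRestrict, hf] at this
      simpa using this.symm
    have e3 := hc (-1)
    rw [e1, e2, List.map_cons, List.sum_cons, ← hS]
    have : y - (u i + S) = y - S + (-1 : ℝ) • u i := by
      rw [neg_one_smul]; abel
    rw [this, e3]
    ring

/-! ### Partitions of a decomposition of the identity -/

section
variable {n ι κ : Type*} [Fintype n] [DecidableEq n] [Fintype ι] [Fintype κ] [Nonempty κ]
  [DecidableEq κ]

/-- The partition theorem, with the partition given by a colouring whose classes may be empty. -/
theorem exists_coloring_norm_sum_le {C : ℝ} (hC : 0 < C) {A : ι → Matrix n n ℂ}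
    (hpsd : ∀ i, (A i).PosSemidef) (hrank : ∀ i, (A i).rank = 1) (hnorm : ∀ i, ‖A i‖ ≤ C)
    (hsum : ∑ i, A i = 1) :
    ∃ c : ι → κ, ∀ j, ‖∑ i with c i = j, A i‖ ≤ (√(1 / (Fintype.card κ : ℝ)) + √C) ^ 2 := by
  classical
  set r := (Fintype.card κ : ℝ) with hr
  have hr0 : 0 < r := by rw [hr]; exact_mod_cast Fintype.card_pos
  -- the barrier point and the step length are optimal for the bound `(1 + √(r C)) ^ 2`
  set e := √(r * C) with he
  have he0 : 0 < e := Real.sqrt_pos.2 (by positivity)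
  have he2 : r * C = e ^ 2 := (Real.sq_sqrt (by positivity)).symm
  obtain ⟨P, hP⟩ := exists_isDetPoly (κ := κ) fun i => (hpsd i).isHermitian
  have hstable := hP.isStable hpsd hsum
  have ht : 0 < e ^ 2 + e := by positivity
  have habove := hP.isAbove hpsd hsum ht
  have hrow : ∀ i : ι, (0 : ι × κ → ℝ) ≤ IsDetPoly.rowDir i := fun i a => by
    simp only [IsDetPoly.rowDir, Pi.zero_apply]; split_ifs <;> norm_num
  have hpot : ∀ i, potential (IsDetPoly.rowDir i) P (fun _ => e ^ 2 + e) ≤ 1 - 1 / (1 + e) := by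
    intro i
    refine (hP.potential_rowDir_le hpsd hrank hsum hC.le hnorm ht i).trans (le_of_eq ?_)
    rw [← hr, he2]
    field_simp
    ring
  have h1 := hstable.isAbove_subDirDerivs hrow habove (by positivity) hpot Finset.univ.toList
  have hrowsum : ((Finset.univ : Finset ι).toList.map
      (IsDetPoly.rowDir (κ := κ))).sum = fun _ => 1 := by
    rw [Finset.sum_map_toList]
    ext a
    simp [IsDetPoly.rowDir]
  have hpt : (fun _ => e ^ 2 + e) + (1 + e) • (fun _ => (1 : ℝ)) =
      fun _ : ι × κ => (1 + e) ^ 2 := by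
    ext a
    simp only [Pi.add_apply, Pi.smul_apply, smul_eq_mul]
    ring
  rw [hrowsum, hpt] at h1
  have hu : ∀ (i : ι) (j : κ), (0 : ι × κ → ℝ) ≤ Pi.single (i, j) r := fun i j =>
    Pi.single_nonneg.2 hr0.le
  obtain ⟨c, hc⟩ := IsStable.exists_choice (u := fun i j => Pi.single (i, j) r) hu hrow
    (fun i => by
      ext ⟨i', j'⟩
      rw [Finset.sum_apply]
      simp only [IsDetPoly.rowDir, Pi.smul_apply, smul_eq_mul, Pi.single_apply, Prod.mk.injEq]
      by_cases hi : i' = i <;> simp [hi, hr])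
    Finset.univ.toList (Finset.nodup_toList _) hstable ⟨_, habove⟩ h1
  have hbound : (√(1 / r) + √C) ^ 2 = (1 + e) ^ 2 / r := by
    rw [he, Real.sqrt_mul hr0.le, Real.sqrt_div zero_le_one, Real.sqrt_one]
    have hs := Real.sq_sqrt hr0.le
    have hs0 := Real.sqrt_pos.2 hr0
    have h2 : 1 / √r + √C = (1 + √r * √C) / √r := by field_simp
    rw [h2, div_pow, hs]
  refine ⟨c, fun j => ?_⟩
  refine (Matrix.posSemidef_sum _ fun i _ => hpsd i).norm_le_of_det_ne_zero (by positivity)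
    fun x hx => ?_
  rw [hbound, div_le_iff₀ hr0] at hx
  -- evaluate on the diagonal at height `x r`
  have h2 := hc (fun _ => x * r - (1 + e) ^ 2) (fun _ => sub_nonneg.2 hx)
  rw [eval_subDirDerivs_of_affine (fun i y => hP.affine_single hpsd hrank i (c i) r y)] at h2
  have h3 := (Complex.ofReal_ne_zero).2 h2.ne'
  rw [hP.ofReal_eval] at h3
  have h4 := Finset.prod_ne_zero_iff.1 h3 j (Finset.mem_univ j)
  set w : ι × κ → ℝ := (fun _ => (1 + e) ^ 2) + (fun _ => x * r - (1 + e) ^ 2) -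
    ((Finset.univ : Finset ι).toList.map fun i => Pi.single (i, c i) r).sum with hw
  have hwa : ∀ i, w (i, j) = x * r - if c i = j then r else 0 := by
    intro i
    rw [hw, Finset.sum_map_toList]
    simp only [Pi.sub_apply, Pi.add_apply, Finset.sum_apply, Pi.single_apply, Prod.mk.injEq]
    rw [add_sub_cancel, Finset.sum_eq_single i]
    · simp [eq_comm]
    · intro i' _ hne; simp [hne.symm]
    · simp
  have h5 : ∑ i, (w (i, j) : ℂ) • A i =
      (r : ℂ) • ((x : ℂ) • (1 : Matrix n n ℂ) - ∑ i with c i = j, A i) := by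
    rw [Finset.sum_filter, ← hsum, Finset.smul_sum, ← Finset.sum_sub_distrib, Finset.smul_sum]
    refine Finset.sum_congr rfl fun i _ => ?_
    rw [hwa]
    split_ifs
    · push_cast; module
    · push_cast; module
  rw [h5, Matrix.det_smul] at h4
  exact right_ne_zero_of_mul h4

end

/-- If there are at least as many indices as colours and every single `A i` obeys a bound on the
colour classes, the colouring can be chosen with all classes nonempty. -/
lemma exists_surjective_coloring {n ι κ : Type*} [Fintype n] [DecidableEq n] [Fintype ι]
    [Fintype κ] [DecidableEq κ] {A : ι → Matrix n n ℂ} (hpsd : ∀ i, (A i).PosSemidef) {B : ℝ}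
    (hB : ∀ i, ‖A i‖ ≤ B) (hcard : Fintype.card κ ≤ Fintype.card ι)
    (h : ∃ c : ι → κ, ∀ j, ‖∑ i with c i = j, A i‖ ≤ B) :
    ∃ c : ι → κ, Function.Surjective c ∧ ∀ j, ‖∑ i with c i = j, A i‖ ≤ B := by
  classical
  -- a colouring with the largest number of colours in use is surjective
  obtain ⟨c₀, hc₀⟩ := h
  obtain ⟨c, hc, hmax⟩ := Finset.exists_max_image
    (Finset.univ.filter fun c : ι → κ => ∀ j, ‖∑ i with c i = j, A i‖ ≤ B)
    (fun c => (Finset.univ.image c).card) ⟨c₀, by simpa using hc₀⟩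
  simp only [Finset.mem_filter, Finset.mem_univ, true_and] at hc hmax
  refine ⟨c, ?_, hc⟩
  by_contra hsurj
  obtain ⟨j, hj⟩ : ∃ j, ∀ i, c i ≠ j := by
    simpa [Function.Surjective] using hsurj
  have hninj : ¬ Function.Injective c := fun hinj =>
    hsurj (((Fintype.bijective_iff_injective_and_card c).2
      ⟨hinj, le_antisymm (Fintype.card_le_of_injective c hinj) hcard⟩).2)
  obtain ⟨a, b, hab, hne⟩ : ∃ a b, c a = c b ∧ a ≠ b := by
    simpa [Function.Injective] using hninj
  have h1 := hmax (Function.update c a j) fun k => by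
    by_cases hk : k = j
    · have : (Finset.univ.filter fun i => Function.update c a j i = k) = {a} := by
        ext i
        by_cases hi : i = a
        · simp [hi, hk]
        · simp [hi, hk, hj i]
      rw [this, Finset.sum_singleton]
      exact hB a
    · refine (Matrix.norm_sum_le_norm_sum_of_subset hpsd fun i hi => ?_).trans (hc k)
      rw [Finset.mem_filter] at hi ⊢
      refine ⟨hi.1, ?_⟩
      by_cases hia : i = a
      · rw [hia, Function.update_self] at hi
        exact absurd hi.2.symm hk
      · simpa [hia] using hi.2
  have h2 : insert j (Finset.univ.image c) ⊆ Finset.univ.image (Function.update c a j) := by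
    intro k hk
    rw [Finset.mem_insert, Finset.mem_image] at hk
    rw [Finset.mem_image]
    rcases hk with rfl | ⟨i, -, rfl⟩
    · exact ⟨a, Finset.mem_univ _, by simp⟩
    · by_cases hia : i = a
      · exact ⟨b, Finset.mem_univ _, by simp [hia, hab, hne.symm]⟩
      · exact ⟨i, Finset.mem_univ _, by simp [hia]⟩
  have h3 := Finset.card_le_card h2
  rw [Finset.card_insert_of_notMem (by simpa using hj)] at h3
  omega

theorem mainTheorem4 (d m r : ℕ) (hr : 2 ≤ r) (C : ℝ) (hC : 0 < C)
    (A : Fin d → Matrix (Fin m) (Fin m) ℂ)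
    (hpsd : ∀ i, (A i).PosSemidef) (hrank : ∀ i, (A i).rank = 1)
    (hnorm : ∀ i, ‖A i‖ ≤ C) (hsum : ∑ i, A i = 1) :
    ∃ S : Fin r → Finset (Fin d),
      (∀ j k, j ≠ k → Disjoint (S j) (S k)) ∧
      (∀ i, ∃ j, i ∈ S j) ∧
      (r ≤ d → ∀ j, (S j).Nonempty) ∧
      ∀ j, ‖∑ i ∈ S j, A i‖ ≤ (√(1 / (r : ℝ)) + √C) ^ 2 := by
  have : Nonempty (Fin r) := ⟨⟨0, by omega⟩⟩
  have hcol := exists_coloring_norm_sum_le (κ := Fin r) hC hpsd hrank hnorm hsum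
  rw [Fintype.card_fin] at hcol
  have hsingle : ∀ i, ‖A i‖ ≤ (√(1 / (r : ℝ)) + √C) ^ 2 := fun i => by
    have h1 := Real.sq_sqrt hC.le
    have h2 := Real.sqrt_nonneg C
    have h3 := Real.sqrt_nonneg (1 / (r : ℝ))
    nlinarith [hnorm i, mul_nonneg h2 h3]
  obtain ⟨c, hsurj, hc⟩ : ∃ c : Fin d → Fin r, (r ≤ d → Function.Surjective c) ∧
      ∀ j, ‖∑ i with c i = j, A i‖ ≤ (√(1 / (r : ℝ)) + √C) ^ 2 := by
    by_cases hrd : r ≤ d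
    · obtain ⟨c, h1, h2⟩ := exists_surjective_coloring hpsd hsingle (by simpa using hrd) hcol
      exact ⟨c, fun _ => h1, h2⟩
    · obtain ⟨c, h2⟩ := hcol
      exact ⟨c, fun h => absurd h hrd, h2⟩
  refine ⟨fun j => Finset.univ.filter fun i => c i = j, fun j k hjk => ?_, fun i => ⟨c i, by simp⟩,
    fun hrd j => ?_, hc⟩
  · rw [Finset.disjoint_left]
    intro i hi hi'
    rw [Finset.mem_filter] at hi hi'
    exact hjk (hi.2.symm.trans hi'.2)
  · obtain ⟨i, hi⟩ := hsurj hrd j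
    exact ⟨i, by simpa using hi⟩
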